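/- **Setting.** There are $K\ge 1$ clients. Client $k$ holds a finite data set $\mathcal D_k$ of $N_k$ points with losses $f_{k,i}(u,v_k)$, where $u\in\mathbb R^p$ is shared and $v_k\in\mathbb R^{q_k}$ is private to client $k$; every $f_{k,i}$ is differentiable in $u$ and in $v_k$. For a mini-batch $B\subseteq\mathcal D_k$ of fixed size $b_k$ ($1\le b_k\le N_k$) let $F_k(u,v_k;B)=\frac1{b_k}\sum_{i\in B}f_{k,i}(u,v_k)$, and let $$F_k(u,v_k)=\frac1{N_k}\sum_{i=1}^{N_k}f_{k,i}(u,v_k),\qquad F(u,V)=\frac1K\sum_{k=1}^K F_k(u,v_k),\qquad V=(v_1,\dots,v_K).$$ **Algorithm (FedCaP).** In each round $t=0,1,2,\dots$ a set $\mathcal S^t$ of $M$ clients ($1\le M\le K$) is drawn uniformly at random without replacement. Each $k\in\mathcal S^t$ starts from $u_{k,0}^t=u^t$, $v_{k,0}^t=v_k^t$ and makes $E\ge1$ local steps $$v^t_{k,e+1}=v^t_{k,e}-\eta_v\nabla_vF_k(u^t_{k,e},v^t_{k,e};B^t_{k,e}),\qquad u^t_{k,e+1}=u^t_{k,e}-\eta_u\nabla_uF_k(u^t_{k,e},v^t_{k,e};B^t_{k,e}),$$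 where $B^t_{k,e}$ is uniform among the $b_k$-point subsets of $\mathcal D_k$, and all random choices are independent. Then $u^{t+1}=\frac1M\sum_{k\in\mathcal S^t}u^t_{k,E}$, $v_k^{t+1}=v^t_{k,E}$ for $k\in\mathcal S^t$, and $v_k^{t+1}=v_k^t$ for $k\notin\mathcal S^t$. The initial point $(u^0,V^0)$ is deterministic. **Assumptions.** 1. For all $k$: $\nabla_uF_k$ is $L_u$-Lipschitz in $u$ and $L_{uv}$-Lipschitz in $v_k$, and $\nabla_vF_k$ is $L_v$-Lipschitz in $v_k$ and $L_{vu}$-Lipschitz in $u$, where $L_u,L_v>0$ and $L_{uv},L_{vu}\ge0$; and $\mathcal X\ge\max\big(\tfrac{L_{uv}}{\sqrt{L_uL_v}},\tfrac{L_{vu}}{\sqrt{L_uL_v}}\big)$. 2. For all $k,u,v_k$: $\mathbb E_B\|\nabla_uF_k(u,v_k;B)-\nabla_uF_k(u,v_k)\|^2\le\sigma_u^2$ and $\mathbb E_B\|\nabla_vF_k(u,v_k;B)-\nabla_vF_k(u,v_k)\|^2\le\sigma_v^2$, where $\sigma_u,\sigma_v\ge0$. 3. For all $u,V$: $\frac1K\sum_{k=1}^K\|\nabla_uF_k(u,v_k)-\nabla_uF(u,V)\|^2\le\zeta^2+P^2\|\nabla_uF(u,V)\|^2$,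 where $\zeta,P\ge0$. 4. $F\ge F^*$ everywhere (for example $F^*=\inf F$, if $F$ is bounded below), and $\Delta:=F(u^0,V^0)-F^*>0$. Put $$\sigma_1^2=\frac{\zeta^2}{L_u}\Big(1-\frac MK\Big)+\frac{\sigma_u^2}{L_u}+\frac{M\sigma_v^2}{KL_v},\qquad \sigma_2^2=\frac{\zeta^2}{L_u}+\frac{\sigma_u^2}{L_u}+\frac{\sigma_v^2}{L_v},$$ $$G_T=\frac1T\sum_{t=0}^{T-1}\Big(\frac1{L_u}\mathbb E\|\nabla_uF(u^t,V^t)\|^2+\frac{M}{L_vK^2}\sum_{k=1}^K\mathbb E\|\nabla_vF_k(u^t,v_k^t)\|^2\Big).$$ **Theorem 1 (Convergence).** There is an absolute constant $A>0$ such that for every number of rounds $T\ge1$ and all values of $K,M,E,L_u,L_v,L_{uv},L_{vu},\mathcal X,\sigma_u,\sigma_v,\zeta,P,\Delta$ as above there are step sizes $\eta_u=\frac{C}{L_uE}$, $\eta_v=\frac{C}{L_vE}$ with $C>0$, which depend only on these values, with $$\eta_u\le\frac1{12EL_u(1+\mathcal X^2)(1+P^2)},\qquad \eta_v\le\frac1{6EL_v(1+\mathcal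 X^2)},$$ such that FedCaP with these step sizes satisfies, for every problem and initial point that meet assumptions 1–4, $$G_T\le A\left(\sqrt{\frac{\Delta(1+\mathcal X^2)\sigma_1^2}{T}}+\sqrt[3]{\frac{\Delta^2(1+\mathcal X^2)\sigma_2^2\,(1-\frac1E)}{T^2}}+\frac{\Delta(1+\mathcal X^2)(1+P^2)}{T}+\frac{\Delta\sqrt{\frac KM(1-\frac1E)(1+\mathcal X^2)(1+P^2)}}{T}\right),$$ that is, $G_T\le\mathcal O(T^{-1/2})+\mathcal O(T^{-2/3})+\mathcal O(T^{-1})$. Moreover the rate is the SGD rate $1/\sqrt T$ beyond an explicit threshold: if $\zeta^2L_v(K-M)+\sigma_u^2L_v+ML_u\sigma_v^2>0$ and $$T\ge\frac{KL_vL_u(1+P^2)\,\Delta}{\zeta^2L_v(K-M)+\sigma_u^2L_v+ML_u\sigma_v^2}$$ (for $M=K$ and $P=0$ this reads $T\ge KL_vL_u\Delta/(\sigma_u^2L_v+KL_u\sigma_v^2)$), then $$G_T\le A\,\kappa\,\sqrt{\frac{\Delta(1+\mathcal X^2)\sigma_1^2}{T}},\qquad \kappa=1+\sqrt{(1+\mathcal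 X^2)(1+P^2)}+\sqrt{\tfrac KM\big(1-\tfrac1E\big)}+\sqrt[3]{\big(1-\tfrac1E\big)\tfrac{\sigma_2^2}{\sigma_1^2}},$$ where the factor $\kappa$ depends neither on $T$ nor on $\Delta$. -/

import Mathlib

open scoped BigOperators

noncomputable section

/-- A personalised federated learning problem with `K` clients.  The shared parameter `u` lives in
`ℝ^p` and the private parameter of client `k` in `ℝ^(q k)`.  Client `k` holds a finite data set of
`N k` points, each with a loss that has a gradient in `u` and a gradient in its private parameter,
and draws mini-batches of `b k` points. -/
structure FedProblem (K : ℕ) where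
  p : ℕ
  q : Fin K → ℕ
  N : Fin K → ℕ
  b : Fin K → ℕ
  b_pos : ∀ k, 1 ≤ b k
  b_le : ∀ k, b k ≤ N k
  loss : (k : Fin K) → Fin (N k) → EuclideanSpace ℝ (Fin p) → EuclideanSpace ℝ (Fin (q k)) → ℝ
  differentiable_u : ∀ k i v, Differentiable ℝ fun u => loss k i u v
  differentiable_v : ∀ k i u, Differentiable ℝ fun v => loss k i u v

namespace FedProblem

variable {K : ℕ} (Q : FedProblem K)

/-- The space of shared parameters. -/
abbrev U : Type := EuclideanSpace ℝ (Fin Q.p)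

/-- The space of private parameters of client `k`. -/
abbrev V (k : Fin K) : Type := EuclideanSpace ℝ (Fin (Q.q k))

/-- The mini-batches of client `k`: the sets of `b k` points of its data set. -/
abbrev Batch (k : Fin K) : Type := {B : Finset (Fin (Q.N k)) // B.card = Q.b k}

/-- The mini-batch loss `F(u, v_k; B)`. -/
def batchLoss (k : Fin K) (B : Q.Batch k) (u : Q.U) (v : Q.V k) : ℝ :=
  (∑ i ∈ B.1, Q.loss k i u v) / (Q.b k : ℝ)

/-- The local objective `F_k(u, v_k)`. -/
def localObj (k : Fin K) (u : Q.U) (v : Q.V k) : ℝ :=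
  (∑ i, Q.loss k i u v) / (Q.N k : ℝ)

/-- The global objective `F(u, V)`, `V = (v_1, …, v_K)`. -/
def globalObj (u : Q.U) (v : (k : Fin K) → Q.V k) : ℝ :=
  (∑ k, Q.localObj k u (v k)) / (K : ℝ)

/-- `∇_u F(u, v_k; B)`. -/
def batchGradU (k : Fin K) (B : Q.Batch k) (u : Q.U) (v : Q.V k) : Q.U :=
  gradient (fun u' => Q.batchLoss k B u' v) u

/-- `∇_v F(u, v_k; B)`. -/
def batchGradV (k : Fin K) (B : Q.Batch k) (u : Q.U) (v : Q.V k) : Q.V k :=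
  gradient (fun v' => Q.batchLoss k B u v') v

/-- `∇_u F_k(u, v_k)`. -/
def localGradU (k : Fin K) (u : Q.U) (v : Q.V k) : Q.U :=
  gradient (fun u' => Q.localObj k u' v) u

/-- `∇_v F_k(u, v_k)`. -/
def localGradV (k : Fin K) (u : Q.U) (v : Q.V k) : Q.V k :=
  gradient (fun v' => Q.localObj k u v') v

/-- `∇_u F(u, V)`. -/
def globalGradU (u : Q.U) (v : (k : Fin K) → Q.V k) : Q.U :=
  gradient (fun u' => Q.globalObj u' v) u

/-! ### Assumptions -/

/-- The partial gradients of every local objective are Lipschitz in each of the two blocks. -/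
structure IsSmooth (Lu Lv Luv Lvu : ℝ) : Prop where
  lip_uu : ∀ k u u' v, ‖Q.localGradU k u v - Q.localGradU k u' v‖ ≤ Lu * ‖u - u'‖
  lip_vu : ∀ k u u' v, ‖Q.localGradV k u v - Q.localGradV k u' v‖ ≤ Lvu * ‖u - u'‖
  lip_vv : ∀ k u v v', ‖Q.localGradV k u v - Q.localGradV k u v'‖ ≤ Lv * ‖v - v'‖
  lip_uv : ∀ k u v v', ‖Q.localGradU k u v - Q.localGradU k u v'‖ ≤ Luv * ‖v - v'‖

/-- The mini-batch gradients have bounded variance; the mini-batch is uniformly distributed. -/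
structure BoundedVariance (σu σv : ℝ) : Prop where
  var_u : ∀ k u v, (𝔼 B : Q.Batch k, ‖Q.batchGradU k B u v - Q.localGradU k u v‖ ^ 2) ≤ σu ^ 2
  var_v : ∀ k u v, (𝔼 B : Q.Batch k, ‖Q.batchGradV k B u v - Q.localGradV k u v‖ ^ 2) ≤ σv ^ 2

/-- The clients' gradients in the shared parameter have bounded diversity. -/
def BoundedHeterogeneity (ζ P : ℝ) : Prop :=
  ∀ (u : Q.U) (v : (k : Fin K) → Q.V k),
    (∑ k, ‖Q.localGradU k u (v k) - Q.globalGradU u v‖ ^ 2) / (K : ℝ)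
      ≤ ζ ^ 2 + P ^ 2 * ‖Q.globalGradU u v‖ ^ 2

/-! ### The algorithm -/

/-- The server's shared parameter together with the private parameters of all the clients. -/
structure State where
  u : Q.U
  v : (k : Fin K) → Q.V k

/-- One local step of client `k` on the mini-batch `B`; both gradients are those of the current
local model `(u_k, v_k)`. -/
def localStep (ηu ηv : ℝ) (k : Fin K) (w : Q.U × Q.V k) (B : Q.Batch k) : Q.U × Q.V k :=
  (w.1 - ηu • Q.batchGradU k B w.1 w.2, w.2 - ηv • Q.batchGradV k B w.1 w.2)

/-- `E` local steps of client `k`, on the mini-batches `Bs 0, …, Bs (E - 1)` in this order. -/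
def localRun (ηu ηv : ℝ) {E : ℕ} (k : Fin K) (Bs : Fin E → Q.Batch k) (w : Q.U × Q.V k) :
    Q.U × Q.V k :=
  Fin.foldl E (fun w e => Q.localStep ηu ηv k w (Bs e)) w

/-- The random choices of one communication round: the set of the `M` selected clients, and for
each client the mini-batches of its `E` local steps (used only if the client is selected).  The
uniform law on this finite type makes the selected set uniform among the sets of `M` clients, every
mini-batch uniform, and all of these choices independent. -/
abbrev Round (M E : ℕ) : Type :=
  {S : Finset (Fin K) // S.card = M} × ((k : Fin K) → Fin E → Q.Batch k)

/-- One communication round: the server averages the shared parameters returned by the selected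
clients; the clients that are not selected keep their private parameters. -/
def roundStep (ηu ηv : ℝ) {M E : ℕ} (o : Q.Round M E) (s : Q.State) : Q.State where
  u := (M : ℝ)⁻¹ • ∑ k ∈ o.1.1, (Q.localRun ηu ηv k (o.2 k) (s.u, s.v k)).1
  v := fun k => if k ∈ o.1.1 then (Q.localRun ηu ηv k (o.2 k) (s.u, s.v k)).2 else s.v k

/-- The state after `t` communication rounds, from the initial state `s₀`, with the choices `ω`. -/
def iterate (ηu ηv : ℝ) {M E : ℕ} (s₀ : Q.State) : (t : ℕ) → (Fin t → Q.Round M E) → Q.State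
  | 0, _ => s₀
  | t + 1, ω => Q.roundStep ηu ηv (ω (Fin.last t)) (iterate ηu ηv s₀ t (Fin.init ω))

/-- The expectation of `φ` at the state after `t` rounds; the rounds are independent, each of them
with uniform choices. -/
def expectAt (ηu ηv : ℝ) (M E : ℕ) (s₀ : Q.State) (t : ℕ) (φ : Q.State → ℝ) : ℝ :=
  𝔼 ω : Fin t → Q.Round M E, φ (Q.iterate ηu ηv s₀ t ω)

/-- The average over the rounds `t = 0, …, T - 1` of the weighted expected squared gradient norms
`(1 / L_u) E‖∇_u F(u^t, V^t)‖² + (M / (L_v K²)) ∑_k E‖∇_v F_k(u^t, v_k^t)‖²`. -/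
def avgSqGrad (ηu ηv : ℝ) (M E T : ℕ) (s₀ : Q.State) (Lu Lv : ℝ) : ℝ :=
  (∑ t ∈ Finset.range T,
    (1 / Lu * Q.expectAt ηu ηv M E s₀ t (fun s => ‖Q.globalGradU s.u s.v‖ ^ 2)
      + (M : ℝ) / (Lv * (K : ℝ) ^ 2) *
        ∑ k, Q.expectAt ηu ηv M E s₀ t (fun s => ‖Q.localGradV k s.u (s.v k)‖ ^ 2))) / (T : ℝ)

end FedProblem

/-- The noise level in front of the term of order `T^(-1/2)`. -/
def noiseOne (K M : ℕ) (Lu Lv σu σv ζ : ℝ) : ℝ :=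
  ζ ^ 2 / Lu * (1 - (M : ℝ) / K) + σu ^ 2 / Lu + (M : ℝ) * σv ^ 2 / (K * Lv)

/-- The noise level in front of the term of order `T^(-2/3)`. -/
def noiseTwo (Lu Lv σu σv ζ : ℝ) : ℝ :=
  ζ ^ 2 / Lu + σu ^ 2 / Lu + σv ^ 2 / Lv

end

/-! Measured in the weighted distance L_u‖du‖² + L_v‖dv‖², both blocks of every local gradient obey
one Lipschitz bound with factor 1 + X² (`IsSmooth.gradU_sub_sq_le`, `IsSmooth.gradV_sub_sq_le`). The
step sizes c/(L_u E) and c/(L_v E) make a whole local run resemble one gradient step of length c/L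
in each block. FedCaP is thus analysed as perturbed SGD with the single parameter c.

The core is the one-round estimate `expect_globalObj_roundStep_le`: the objective decreases by c/4
times the weighted squared gradient, up to errors of order c² σ₁² and c³ (1 - 1/E) σ₂². In the
linear part of the descent inequality, mini-batches are unbiased given the past, so only the drift
of the local model from its start contributes an error. The quadratic part carries the noise of
order c². Client sampling enters it through vectors of sum zero, whose random partial sums have
second moment proportional to 1 - M/K (`expect_norm_sum_subset_sq_le`). The drift is itself of order
c² and absent for E = 1 (`localDrift_le`); multiplied by the c of the linear part it gives the c³
term.

Telescoping over the rounds bounds the average squared gradient by Δ/(cT) + c σ₁² + c² σ₂², up to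
factors (`avgSqGrad_le`). Taking 1/c to be the sum of all lower bounds that 1/c has to satisfy
balances these terms (`balanced_rate_le`). For large T the first resulting term controls the others
(`rate_le_of_threshold`). -/

/-! ### Finite averages, independence and random subsets. -/

/-- Averaging does not see a fresh resampling of one coordinate. -/
theorem expect_update {ι : Type*} [Fintype ι] [DecidableEq ι] {β : ι → Type*}
    [∀ i, Fintype (β i)] (i : ι) [Nonempty (β i)] (g : ((j : ι) → β j) → ℝ) :
    𝔼 x : (j : ι) → β j, 𝔼 b : β i, g (Function.update x i b) = 𝔼 x : (j : ι) → β j, g x := by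
  -- Exchanging the `i`-th coordinate with the fresh sample is an involution of the product, hence
  -- preserves the uniform law.
  let e : ((j : ι) → β j) × β i ≃ ((j : ι) → β j) × β i :=
    { toFun := fun p => (Function.update p.1 i p.2, p.1 i)
      invFun := fun p => (Function.update p.1 i p.2, p.1 i)
      left_inv := fun p => by simp
      right_inv := fun p => by simp }
  rw [← Finset.expect_product' Finset.univ Finset.univ
    (fun (x : (j : ι) → β j) (b : β i) => g (Function.update x i b)), Finset.univ_product_univ]
  calc 𝔼 p : ((j : ι) → β j) × β i, g (Function.update p.1 i p.2)
      = 𝔼 p : ((j : ι) → β j) × β i, g p.1 := Fintype.expect_equiv e _ _ (fun p => rfl)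
    _ = 𝔼 x : (j : ι) → β j, 𝔼 _b : β i, g x := by
        rw [← Finset.univ_product_univ, Finset.expect_product]
    _ = _ := by simp only [Fintype.expect_const]

/-- A coordinate is independent of any quantity that does not depend on it. -/
theorem expect_coord_of_update_eq {ι : Type*} [Fintype ι] [DecidableEq ι] {β : ι → Type*}
    [∀ i, Fintype (β i)] (i : ι) [Nonempty (β i)] (f : ((j : ι) → β j) → β i → ℝ)
    (hf : ∀ x b, f (Function.update x i b) = f x) :
    𝔼 x : (j : ι) → β j, f x (x i) = 𝔼 x : (j : ι) → β j, 𝔼 b : β i, f x b := by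
  rw [← expect_update i]
  simp [hf]

theorem expect_coord {ι : Type*} [Fintype ι] [DecidableEq ι] {β : ι → Type*}
    [∀ i, Fintype (β i)] [∀ i, Nonempty (β i)] (i : ι) (f : β i → ℝ) :
    𝔼 x : (j : ι) → β j, f (x i) = 𝔼 b : β i, f b := by
  rw [expect_coord_of_update_eq i (fun _ => f) (fun _ _ => rfl), Fintype.expect_const]

theorem expect_init_last {α : Type*} [Fintype α] (t : ℕ) (f : (Fin t → α) → α → ℝ) :
    𝔼 ω : Fin (t + 1) → α, f (Fin.init ω) (ω (Fin.last t))
      = 𝔼 ω : Fin t → α, 𝔼 a : α, f ω a := by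
  rw [Finset.expect_comm, ← Finset.expect_product' Finset.univ Finset.univ
    (fun (a : α) (ω : Fin t → α) => f ω a), Finset.univ_product_univ]
  refine (Fintype.expect_equiv (Fin.snocEquiv fun _ => α) _ _ fun p => ?_).symm
  simp [Fin.snocEquiv]

/-- Each element lies in a uniformly random `m`-subset with probability `m / card α`. -/
theorem expect_sum_mem_subset {α : Type*} [Fintype α] [DecidableEq α] {m : ℕ}
    (hm : m ≤ Fintype.card α) (hα : 0 < Fintype.card α) (f : α → ℝ) :
    𝔼 S : {S : Finset α // S.card = m}, ∑ a ∈ S.1, f a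
      = (m : ℝ) / Fintype.card α * ∑ a, f a := by
  have hne : Nonempty {S : Finset α // S.card = m} := by
    obtain ⟨S, -, hS⟩ := Finset.exists_subset_card_eq (s := (Finset.univ : Finset α)) hm
    exact ⟨⟨S, hS⟩⟩
  let p : α → ℝ := fun a => 𝔼 S : {S : Finset α // S.card = m}, if a ∈ S.1 then 1 else 0
  -- The transposition of `a` and `b` permutes the `m`-subsets, so all inclusion probabilities
  -- agree; their sum is `m`.
  have hp : ∀ a b, p a = p b := by
    intro a b
    refine Fintype.expect_equiv ((Equiv.finsetCongr (Equiv.swap a b)).subtypeEquiv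
      (fun S => by simp)) _ _ fun S => ?_
    simp [Equiv.finsetCongr]
  have hsum : ∑ a, p a = m := by
    rw [← Finset.expect_sum_comm]
    simp only [Finset.sum_ite_mem, Finset.univ_inter, Finset.sum_const, nsmul_eq_mul, mul_one]
    rw [Finset.expect_congr rfl (g := fun _ => (m : ℝ)) (fun S _ => by rw [S.2]),
      Fintype.expect_const]
  have hpa : ∀ a, p a = (m : ℝ) / Fintype.card α := by
    intro a
    rw [Finset.sum_congr rfl (fun b _ => hp b a)] at hsum
    simp only [Finset.sum_const, Finset.card_univ, nsmul_eq_mul] at hsum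
    rw [← hsum]
    field_simp
  calc 𝔼 S : {S : Finset α // S.card = m}, ∑ a ∈ S.1, f a
      = 𝔼 S : {S : Finset α // S.card = m}, ∑ a, (if a ∈ S.1 then 1 else 0) * f a := by
        simp
    _ = ∑ a, p a * f a := by
        rw [Finset.expect_sum_comm]
        simp only [p, Finset.expect_mul]
    _ = _ := by simp only [hpa, Finset.mul_sum]

/-! ### Second moments, the descent lemma and linear terms. -/

theorem norm_sum_sq_le_card_mul {ι H : Type*} [SeminormedAddCommGroup H] (s : Finset ι)
    (a : ι → H) : ‖∑ i ∈ s, a i‖ ^ 2 ≤ s.card * ∑ i ∈ s, ‖a i‖ ^ 2 :=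
  (pow_le_pow_left₀ (norm_nonneg _) (norm_sum_le s a) 2).trans sq_sum_le_card_mul_sum_sq

theorem norm_add_sq_le_two_mul {H : Type*} [SeminormedAddCommGroup H] (a b : H) :
    ‖a + b‖ ^ 2 ≤ 2 * ‖a‖ ^ 2 + 2 * ‖b‖ ^ 2 := by
  have h := pow_le_pow_left₀ (norm_nonneg _) (norm_add_le a b) 2
  nlinarith [sq_nonneg (‖a‖ - ‖b‖)]

/-- Second moment of a sum of `n` noisy gradients around `n` times a reference vector. -/
theorem expect_norm_sum_sub_sq_le {Ω H : Type*} [Fintype Ω] [SeminormedAddCommGroup H]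
    {a m : ℕ → Ω → H} {σ : ℝ} (g : H) (n : ℕ)
    (hvar : ∀ j < n, 𝔼 x, ‖a j x - m j x‖ ^ 2 ≤ σ ^ 2) :
    𝔼 x, ‖∑ j ∈ Finset.range n, (a j x - g)‖ ^ 2
      ≤ 2 * n * (∑ j ∈ Finset.range n, 𝔼 x, ‖m j x - g‖ ^ 2 + n * σ ^ 2) := by
  -- Plain Cauchy–Schwarz, without orthogonality of the noises: they cost n²σ² instead of nσ². This
  -- suffices because the step size carries a factor 1/E and the target noise levels contain no gain
  -- in E.
  have h1 : ∀ x, ‖∑ j ∈ Finset.range n, (a j x - g)‖ ^ 2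
      ≤ ∑ j ∈ Finset.range n, (n * 2 * ‖m j x - g‖ ^ 2 + n * 2 * ‖a j x - m j x‖ ^ 2) := by
    intro x
    refine (norm_sum_sq_le_card_mul _ _).trans ?_
    rw [Finset.card_range, Finset.mul_sum]
    refine Finset.sum_le_sum fun j _ => ?_
    have h := norm_add_sq_le_two_mul (m j x - g) (a j x - m j x)
    rw [sub_add_sub_cancel'] at h
    nlinarith [mul_le_mul_of_nonneg_left h (Nat.cast_nonneg (α := ℝ) n)]
  refine (Finset.expect_le_expect fun x _ => h1 x).trans ?_
  rw [Finset.expect_sum_comm]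
  simp only [Finset.expect_add_distrib, ← Finset.mul_expect]
  rw [Finset.sum_add_distrib, ← Finset.mul_sum, ← Finset.mul_sum]
  have h2 : ∑ j ∈ Finset.range n, 𝔼 x, ‖a j x - m j x‖ ^ 2 ≤ n * σ ^ 2 := by
    refine (Finset.sum_le_sum fun j hj => hvar j (Finset.mem_range.1 hj)).trans ?_
    simp
  nlinarith [mul_le_mul_of_nonneg_left h2 (Nat.cast_nonneg (α := ℝ) n)]

section InnerProduct

variable {H : Type*} [NormedAddCommGroup H] [InnerProductSpace ℝ H]

theorem inner_le_half_sq_add_half_sq (a b : H) :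
    inner ℝ a b ≤ ‖a‖ ^ 2 / 2 + ‖b‖ ^ 2 / 2 := by
  have h := real_inner_le_norm a b
  nlinarith [sq_nonneg (‖a‖ - ‖b‖)]

/-- The descent lemma. -/
theorem le_add_inner_gradient_of_lipschitz [CompleteSpace H] {f : H → ℝ} (hf : Differentiable ℝ f)
    {L : ℝ} (hL : ∀ x y, ‖gradient f x - gradient f y‖ ≤ L * ‖x - y‖) (x y : H) :
    f y ≤ f x + inner ℝ (gradient f x) (y - x) + L / 2 * ‖y - x‖ ^ 2 := by
  set d := y - x with hd
  -- The Lipschitz bound makes the derivative of this function nonpositive on [0, 1]; comparing its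
  -- values at 0 and 1 gives the claim.
  let φ : ℝ → ℝ := fun s => f (x + s • d) - s * inner ℝ (gradient f x) d - s ^ 2 * (L / 2 * ‖d‖ ^ 2)
  have hφ : ∀ s, HasDerivAt φ (inner ℝ (gradient f (x + s • d)) d - inner ℝ (gradient f x) d
      - 2 * s * (L / 2 * ‖d‖ ^ 2)) s := by
    intro s
    have h1 : HasDerivAt (fun s : ℝ => x + s • d) d s := by
      simpa using ((hasDerivAt_id s).smul_const d).const_add x
    have h2 : HasDerivAt (fun s : ℝ => f (x + s • d)) (inner ℝ (gradient f (x + s • d)) d) s := by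
      rw [inner_gradient_left]
      exact (hf (x + s • d)).hasFDerivAt.comp_hasDerivAt s h1
    have h3 := (h2.sub ((hasDerivAt_id s).mul_const (inner ℝ (gradient f x) d))).sub
      ((hasDerivAt_pow 2 s).mul_const (L / 2 * ‖d‖ ^ 2))
    refine h3.congr_deriv ?_
    simp
  have hanti : AntitoneOn φ (Set.Icc 0 1) := by
    refine antitoneOn_of_deriv_nonpos (convex_Icc 0 1)
      (fun s _ => (hφ s).continuousAt.continuousWithinAt)
      (fun s _ => (hφ s).differentiableAt.differentiableWithinAt) fun s hs => ?_
    rw [interior_Icc] at hs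
    rw [(hφ s).deriv, ← inner_sub_left]
    have h1 := real_inner_le_norm (gradient f (x + s • d) - gradient f x) d
    have h2 := hL (x + s • d) x
    rw [add_sub_cancel_left, norm_smul, Real.norm_of_nonneg hs.1.le] at h2
    nlinarith [mul_le_mul_of_nonneg_right h2 (norm_nonneg d)]
  have h := hanti (Set.left_mem_Icc.2 zero_le_one) (Set.right_mem_Icc.2 zero_le_one) zero_le_one
  simp only [φ, one_smul, zero_smul, hd, add_sub_cancel, one_mul, zero_mul, one_pow, add_zero,
    sub_zero, zero_pow two_ne_zero] at h
  linarith

/-- Unbiasedness replaces `a` by `m` before Young's inequality is applied, so the variance never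
enters the linear term. -/
theorem expect_inner_sum_sub_le {Ω : Type*} [Fintype Ω] [Nonempty Ω] {a m : ℕ → Ω → H} (g G : H) (n : ℕ)
    (hmean : ∀ j < n, 𝔼 x, inner ℝ G (a j x) = 𝔼 x, inner ℝ G (m j x)) :
    𝔼 x, inner ℝ G (-∑ j ∈ Finset.range n, (a j x - g))
      ≤ n / 2 * ‖G‖ ^ 2 + (∑ j ∈ Finset.range n, 𝔼 x, ‖m j x - g‖ ^ 2) / 2 := by
  have h1 : ∀ x, inner ℝ G (-∑ j ∈ Finset.range n, (a j x - g))
      = ∑ j ∈ Finset.range n, (inner ℝ G g - inner ℝ G (a j x)) := by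
    intro x
    rw [← Finset.sum_neg_distrib, inner_sum]
    simp [inner_sub_right]
  simp only [h1]
  rw [Finset.expect_sum_comm]
  have h2 : ∀ j ∈ Finset.range n, 𝔼 x, (inner ℝ G g - inner ℝ G (a j x))
      ≤ ‖G‖ ^ 2 / 2 + (𝔼 x, ‖m j x - g‖ ^ 2) / 2 := by
    intro j hj
    rw [Finset.expect_sub_distrib, hmean j (Finset.mem_range.1 hj), ← Finset.expect_sub_distrib]
    have h3 : ∀ x, inner ℝ G g - inner ℝ G (m j x) ≤ ‖G‖ ^ 2 / 2 + ‖m j x - g‖ ^ 2 / 2 := by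
      intro x
      rw [← inner_sub_right]
      refine (inner_le_half_sq_add_half_sq _ _).trans ?_
      rw [norm_sub_rev]
    refine (Finset.expect_le_expect fun x _ => h3 x).trans ?_
    rw [Finset.expect_add_distrib, Fintype.expect_const, Finset.expect_div]
  refine (Finset.sum_le_sum h2).trans ?_
  rw [Finset.sum_add_distrib, Finset.sum_const, Finset.card_range, nsmul_eq_mul, Finset.sum_div]
  apply le_of_eq
  ring

end InnerProduct

theorem differentiable_sum_div {ι H : Type*} [NormedAddCommGroup H] [InnerProductSpace ℝ H]
    {f : ι → H → ℝ} (hf : ∀ i, Differentiable ℝ (f i)) (s : Finset ι) (c : ℝ) :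
    Differentiable ℝ fun x => (∑ i ∈ s, f i x) / c := by
  fun_prop

theorem gradient_sum_div {ι H : Type*} [NormedAddCommGroup H] [InnerProductSpace ℝ H]
    [CompleteSpace H] {f : ι → H → ℝ} (hf : ∀ i, Differentiable ℝ (f i)) (s : Finset ι) (c : ℝ)
    (x : H) :
    gradient (fun x => (∑ i ∈ s, f i x) / c) x = c⁻¹ • ∑ i ∈ s, gradient (f i) x := by
  refine ext_inner_left ℝ fun G => ?_
  rw [inner_gradient_right, inner_smul_right, inner_sum]
  simp only [inner_gradient_right, conj_trivial, div_eq_inv_mul]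
  have h : HasFDerivAt (fun x => c⁻¹ * ∑ i ∈ s, f i x) (c⁻¹ • ∑ i ∈ s, fderiv ℝ (f i) x) x :=
    (HasFDerivAt.fun_sum fun i _ => (hf i x).hasFDerivAt).const_mul c⁻¹
  rw [h.fderiv]
  simp

theorem sum_expect_norm_sub_sq_le {Ω H : Type*} [Fintype Ω] [SeminormedAddCommGroup H]
    {m : ℕ → Ω → H} {d : ℕ → Ω → ℝ} {g : H} {L ρ : ℝ}
    (hd : ∀ j x, ‖m j x - g‖ ^ 2 ≤ L * ρ * d j x) (n : ℕ) :
    ∑ j ∈ Finset.range n, 𝔼 x, ‖m j x - g‖ ^ 2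
      ≤ L * ρ * ∑ j ∈ Finset.range n, 𝔼 x, d j x := by
  rw [Finset.mul_sum]
  refine Finset.sum_le_sum fun j _ => ?_
  rw [Finset.mul_expect]
  exact Finset.expect_le_expect fun x _ => hd j x

/-! ### Gradient steps of one block, treated abstractly so as to serve both u and v. -/

theorem block_sub_add_smul {Ω H : Type*} [AddCommGroup H] [Module ℝ H] {a y : ℕ → Ω → H} {y₀ g : H}
    {η : ℝ} (hy : ∀ n x, y n x = y₀ - η • ∑ j ∈ Finset.range n, a j x) (n : ℕ) (x : Ω) :
    y n x - y₀ + (η * n) • g = η • -∑ j ∈ Finset.range n, (a j x - g) := by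
  rw [hy, Finset.sum_sub_distrib, Finset.sum_const, Finset.card_range, ← Nat.cast_smul_eq_nsmul ℝ]
  module

section Block

variable {Ω H : Type*} [Fintype Ω] [NormedAddCommGroup H] [InnerProductSpace ℝ H]
  {a m y : ℕ → Ω → H} {d : ℕ → Ω → ℝ} {g y₀ : H} {σ L ρ c : ℝ} {τ : ℕ}

/-- Distance after `n` steps of a block from the deterministic step along `g`. -/
theorem expect_norm_block_sub_add_smul_sq_le
    (hy : ∀ n x, y n x = y₀ - (c / (L * τ)) • ∑ j ∈ Finset.range n, a j x)
    (hvar : ∀ j < τ, 𝔼 x, ‖a j x - m j x‖ ^ 2 ≤ σ ^ 2)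
    (hd : ∀ j x, ‖m j x - g‖ ^ 2 ≤ L * ρ * d j x) {n : ℕ} (hn : n ≤ τ) :
    𝔼 x, ‖y n x - y₀ + (c / (L * τ) * n) • g‖ ^ 2
      ≤ (c / (L * τ)) ^ 2 * (2 * n * (L * ρ * ∑ j ∈ Finset.range n, 𝔼 x, d j x + n * σ ^ 2)) := by
  simp only [block_sub_add_smul hy, norm_smul, norm_neg, mul_pow, Real.norm_eq_abs, sq_abs]
  rw [← Finset.mul_expect]
  refine mul_le_mul_of_nonneg_left ?_ (sq_nonneg _)
  refine (expect_norm_sum_sub_sq_le g n fun j hj => hvar j (hj.trans_le hn)).trans ?_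
  gcongr
  exact sum_expect_norm_sub_sq_le hd n

theorem expect_norm_block_end_sq_le (hτ : 1 ≤ τ) (hL : 0 < L)
    (hy : ∀ n x, y n x = y₀ - (c / (L * τ)) • ∑ j ∈ Finset.range n, a j x)
    (hvar : ∀ j < τ, 𝔼 x, ‖a j x - m j x‖ ^ 2 ≤ σ ^ 2)
    (hd : ∀ j x, ‖m j x - g‖ ^ 2 ≤ L * ρ * d j x) :
    L * 𝔼 x, ‖y τ x - y₀ + (c / L) • g‖ ^ 2
      ≤ 2 * c ^ 2 * (ρ * ((∑ j ∈ Finset.range τ, 𝔼 x, d j x) / τ) + σ ^ 2 / L) := by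
  have hτ' : (0 : ℝ) < τ := by exact_mod_cast hτ
  have h := expect_norm_block_sub_add_smul_sq_le hy hvar hd le_rfl
  have e : c / (L * τ) * τ = c / L := by field_simp
  rw [e] at h
  refine (mul_le_mul_of_nonneg_left h hL.le).trans (le_of_eq ?_)
  field_simp

/-- Movement of a block during the first `n` steps. -/
theorem expect_norm_block_sub_sq_le [Nonempty Ω] (hτ : 1 ≤ τ) (hL : 0 < L)
    (hy : ∀ n x, y n x = y₀ - (c / (L * τ)) • ∑ j ∈ Finset.range n, a j x)
    (hvar : ∀ j < τ, 𝔼 x, ‖a j x - m j x‖ ^ 2 ≤ σ ^ 2)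
    (hd : ∀ j x, ‖m j x - g‖ ^ 2 ≤ L * ρ * d j x) {n : ℕ} (hn : n ≤ τ) :
    L * 𝔼 x, ‖y n x - y₀‖ ^ 2
      ≤ c ^ 2 / τ ^ 2 * (2 * n ^ 2 * (‖g‖ ^ 2 / L)
        + 4 * n * ρ * ∑ j ∈ Finset.range n, 𝔼 x, d j x + 4 * n ^ 2 * (σ ^ 2 / L)) := by
  have hτ' : (0 : ℝ) < τ := by exact_mod_cast hτ
  have h := expect_norm_block_sub_add_smul_sq_le hy hvar hd hn
  have h1 : ∀ x, ‖y n x - y₀‖ ^ 2 ≤ 2 * ‖y n x - y₀ + (c / (L * τ) * n) • g‖ ^ 2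
      + 2 * ((c / (L * τ) * n) ^ 2 * ‖g‖ ^ 2) := by
    intro x
    have h2 := norm_add_sq_le_two_mul (y n x - y₀ + (c / (L * τ) * n) • g)
      (-((c / (L * τ) * n) • g))
    rwa [add_neg_cancel_right, norm_neg, norm_smul (c / (L * τ) * n) g, mul_pow, Real.norm_eq_abs,
      sq_abs] at h2
  have h3 := Finset.expect_le_expect (s := Finset.univ) fun x _ => h1 x
  rw [Finset.expect_add_distrib, ← Finset.mul_expect, Fintype.expect_const] at h3
  refine (mul_le_mul_of_nonneg_left (h3.trans (add_le_add_left
    (mul_le_mul_of_nonneg_left h zero_le_two) _)) hL.le).trans (le_of_eq ?_)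
  field_simp
  ring

/-- The test vector `G` is kept apart from the reference gradient `g`: the shared block is tested
against the global gradient although the client follows its local one. For the private block the two
coincide. -/
theorem expect_inner_block_end_le [Nonempty Ω] (hτ : 1 ≤ τ) (hL : 0 < L) (hc : 0 < c)
    (hy : ∀ n x, y n x = y₀ - (c / (L * τ)) • ∑ j ∈ Finset.range n, a j x) (G : H)
    (hmean : ∀ j < τ, 𝔼 x, inner ℝ G (a j x) = 𝔼 x, inner ℝ G (m j x))
    (hd : ∀ j x, ‖m j x - g‖ ^ 2 ≤ L * ρ * d j x) :
    𝔼 x, inner ℝ G (y τ x - y₀)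
      ≤ - (c / L) * inner ℝ G g + c / 2 * (‖G‖ ^ 2 / L)
        + c / 2 * ρ * ((∑ j ∈ Finset.range τ, 𝔼 x, d j x) / τ) := by
  have hτ' : (0 : ℝ) < τ := by exact_mod_cast hτ
  have e : c / (L * τ) * τ = c / L := by field_simp
  have h1 : ∀ x, inner ℝ G (y τ x - y₀) = c / (L * τ) * inner ℝ G (-∑ j ∈ Finset.range τ, (a j x - g))
      + - (c / L) * inner ℝ G g := by
    intro x
    rw [← inner_smul_right, ← block_sub_add_smul hy, e, inner_add_right, inner_smul_right]
    ring
  simp only [h1]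
  rw [Finset.expect_add_distrib, ← Finset.mul_expect, Fintype.expect_const]
  have h2 := (expect_inner_sum_sub_le g G τ hmean).trans (add_le_add_right
    (div_le_div_of_nonneg_right (sum_expect_norm_sub_sq_le hd τ) zero_le_two) _)
  have h3 := mul_le_mul_of_nonneg_left h2 (show 0 ≤ c / (L * τ) by positivity)
  refine (add_le_add_left h3 _).trans (le_of_eq ?_)
  field_simp
  ring

end Block

/-! ### Unbiased mini-batches and the local run. -/

namespace FedProblem

variable {K : ℕ} (Q : FedProblem K)

instance (k : Fin K) : Nonempty (Q.Batch k) := by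
  obtain ⟨S, -, hS⟩ := Finset.exists_subset_card_eq (s := (Finset.univ : Finset (Fin (Q.N k))))
    (by simpa using Q.b_le k)
  exact ⟨⟨S, hS⟩⟩

theorem differentiable_localObj_u (k : Fin K) (v : Q.V k) :
    Differentiable ℝ fun u => Q.localObj k u v :=
  differentiable_sum_div (fun i => Q.differentiable_u k i v) _ _

theorem differentiable_localObj_v (k : Fin K) (u : Q.U) :
    Differentiable ℝ fun v => Q.localObj k u v :=
  differentiable_sum_div (fun i => Q.differentiable_v k i u) _ _

theorem globalGradU_eq (u : Q.U) (v : (k : Fin K) → Q.V k) :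
    Q.globalGradU u v = (K : ℝ)⁻¹ • ∑ k, Q.localGradU k u (v k) :=
  gradient_sum_div (fun k => Q.differentiable_localObj_u k (v k)) _ _ u

/-- The average over the mini-batches is the average over the data. -/
theorem expect_batch_inner_gradient {H : Type*} [NormedAddCommGroup H] [InnerProductSpace ℝ H]
    [CompleteSpace H] (k : Fin K) {f : Fin (Q.N k) → H → ℝ} (hf : ∀ i, Differentiable ℝ (f i))
    (G x : H) :
    𝔼 B : Q.Batch k, inner ℝ G (gradient (fun y => (∑ i ∈ B.1, f i y) / (Q.b k : ℝ)) x)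
      = inner ℝ G (gradient (fun y => (∑ i, f i y) / (Q.N k : ℝ)) x) := by
  have hb : (0 : ℝ) < Q.b k := by exact_mod_cast Q.b_pos k
  have hN : 0 < Q.N k := (Q.b_pos k).trans (Q.b_le k)
  simp only [gradient_sum_div hf, inner_smul_right, inner_sum]
  rw [← Finset.mul_expect, expect_sum_mem_subset (by simpa using Q.b_le k) (by simpa using hN)]
  simp only [Fintype.card_fin]
  field_simp

theorem expect_inner_batchGradU (k : Fin K) (G u : Q.U) (v : Q.V k) :
    𝔼 B : Q.Batch k, inner ℝ G (Q.batchGradU k B u v) = inner ℝ G (Q.localGradU k u v) :=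
  Q.expect_batch_inner_gradient k (fun i => Q.differentiable_u k i v) G u

theorem expect_inner_batchGradV (k : Fin K) (u : Q.U) (G v : Q.V k) :
    𝔼 B : Q.Batch k, inner ℝ G (Q.batchGradV k B u v) = inner ℝ G (Q.localGradV k u v) :=
  Q.expect_batch_inner_gradient k (fun i => Q.differentiable_v k i u) G v

/-- The local model after the first `n` steps. -/
noncomputable def localIter (ηu ηv : ℝ) {E : ℕ} (k : Fin K) (Bs : Fin E → Q.Batch k) (w : Q.U × Q.V k) :
    ℕ → Q.U × Q.V k
  | 0 => w
  | n + 1 => if h : n < E then Q.localStep ηu ηv k (localIter ηu ηv k Bs w n) (Bs ⟨n, h⟩)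
      else localIter ηu ηv k Bs w n

variable {ηu ηv : ℝ} {E : ℕ} {k : Fin K}

theorem localIter_eq_foldl (Bs : Fin E → Q.Batch k) (w : Q.U × Q.V k) (n : ℕ) (hn : n ≤ E) :
    Q.localIter ηu ηv k Bs w n
      = Fin.foldl n (fun w e => Q.localStep ηu ηv k w (Bs (Fin.castLE hn e))) w := by
  induction n with
  | zero => simp [localIter]
  | succ n ih =>
    rw [localIter, dif_pos (Nat.lt_of_succ_le hn), Fin.foldl_succ_last, ih (Nat.le_of_succ_le hn)]
    rfl

theorem localRun_eq_localIter (Bs : Fin E → Q.Batch k) (w : Q.U × Q.V k) :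
    Q.localRun ηu ηv k Bs w = Q.localIter ηu ηv k Bs w E := by
  rw [localIter_eq_foldl _ _ _ _ le_rfl]
  rfl

/-- Batch `j` is first read in passing from iterate `j` to iterate `j + 1`; the case `n = j` is the
one that yields independence. -/
theorem localIter_update (Bs : Fin E → Q.Batch k) (w : Q.U × Q.V k) (j : Fin E) (B : Q.Batch k)
    (n : ℕ) (hn : n ≤ j) :
    Q.localIter ηu ηv k (Function.update Bs j B) w n = Q.localIter ηu ηv k Bs w n := by
  induction n with
  | zero => rfl
  | succ n ih =>
    have hlt : n < E := (Nat.lt_of_succ_le hn).trans j.2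
    have hne : (⟨n, hlt⟩ : Fin E) ≠ j := fun h => by simp [← h] at hn
    simp only [localIter, dif_pos hlt, ih (Nat.le_of_succ_le hn), Function.update_of_ne hne]

/-- The mini-batch of a step is independent of the local model before the step. -/
theorem expect_localIter (w : Q.U × Q.V k) (j : Fin E) (φ : Q.U × Q.V k → Q.Batch k → ℝ) :
    𝔼 Bs : Fin E → Q.Batch k, φ (Q.localIter ηu ηv k Bs w j) (Bs j)
      = 𝔼 Bs : Fin E → Q.Batch k, 𝔼 B : Q.Batch k, φ (Q.localIter ηu ηv k Bs w j) B :=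
  expect_coord_of_update_eq (β := fun _ : Fin E => Q.Batch k) j
    (fun Bs => φ (Q.localIter ηu ηv k Bs w j))
    (fun Bs B => by rw [localIter_update _ _ _ _ _ _ le_rfl])

/-- The stochastic gradients along a local run; zero after its end. -/
noncomputable def stepGradU (ηu ηv : ℝ) (k : Fin K) (w : Q.U × Q.V k) (n : ℕ) (Bs : Fin E → Q.Batch k) : Q.U :=
  if h : n < E then
    Q.batchGradU k (Bs ⟨n, h⟩) (Q.localIter ηu ηv k Bs w n).1 (Q.localIter ηu ηv k Bs w n).2
  else 0

noncomputable def stepGradV (ηu ηv : ℝ) (k : Fin K) (w : Q.U × Q.V k) (n : ℕ) (Bs : Fin E → Q.Batch k) :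
    Q.V k :=
  if h : n < E then
    Q.batchGradV k (Bs ⟨n, h⟩) (Q.localIter ηu ηv k Bs w n).1 (Q.localIter ηu ηv k Bs w n).2
  else 0

/-- After `E` steps the iterate is frozen and the recorded gradients are zero, so the formula needs
no bound on `n`. -/
theorem localIter_fst_eq (w : Q.U × Q.V k) (n : ℕ) (Bs : Fin E → Q.Batch k) :
    (Q.localIter ηu ηv k Bs w n).1
      = w.1 - ηu • ∑ j ∈ Finset.range n, Q.stepGradU ηu ηv k w j Bs := by
  induction n with
  | zero => simp [localIter]
  | succ n ih =>
    rw [Finset.sum_range_succ, smul_add, ← sub_sub, ← ih, localIter, stepGradU]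
    split_ifs <;> simp [localStep]

theorem localIter_snd_eq (w : Q.U × Q.V k) (n : ℕ) (Bs : Fin E → Q.Batch k) :
    (Q.localIter ηu ηv k Bs w n).2
      = w.2 - ηv • ∑ j ∈ Finset.range n, Q.stepGradV ηu ηv k w j Bs := by
  induction n with
  | zero => simp [localIter]
  | succ n ih =>
    rw [Finset.sum_range_succ, smul_add, ← sub_sub, ← ih, localIter, stepGradV]
    split_ifs <;> simp [localStep]

theorem expect_inner_stepGradU (w : Q.U × Q.V k) (G : Q.U) (j : ℕ) (hj : j < E) :
    𝔼 Bs : Fin E → Q.Batch k, inner ℝ G (Q.stepGradU ηu ηv k w j Bs)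
      = 𝔼 Bs : Fin E → Q.Batch k, inner ℝ G (Q.localGradU k (Q.localIter ηu ηv k Bs w j).1
          (Q.localIter ηu ηv k Bs w j).2) := by
  simp only [stepGradU, dif_pos hj]
  rw [Q.expect_localIter w ⟨j, hj⟩ fun z B => inner ℝ G (Q.batchGradU k B z.1 z.2)]
  simp only [expect_inner_batchGradU]

theorem expect_inner_stepGradV (w : Q.U × Q.V k) (G : Q.V k) (j : ℕ) (hj : j < E) :
    𝔼 Bs : Fin E → Q.Batch k, inner ℝ G (Q.stepGradV ηu ηv k w j Bs)
      = 𝔼 Bs : Fin E → Q.Batch k, inner ℝ G (Q.localGradV k (Q.localIter ηu ηv k Bs w j).1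
          (Q.localIter ηu ηv k Bs w j).2) := by
  simp only [stepGradV, dif_pos hj]
  rw [Q.expect_localIter w ⟨j, hj⟩ fun z B => inner ℝ G (Q.batchGradV k B z.1 z.2)]
  simp only [expect_inner_batchGradV]

variable {Q} {σu σv : ℝ}

theorem BoundedVariance.expect_stepGradU (h : Q.BoundedVariance σu σv) (w : Q.U × Q.V k) (j : ℕ)
    (hj : j < E) :
    𝔼 Bs : Fin E → Q.Batch k, ‖Q.stepGradU ηu ηv k w j Bs
      - Q.localGradU k (Q.localIter ηu ηv k Bs w j).1 (Q.localIter ηu ηv k Bs w j).2‖ ^ 2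
      ≤ σu ^ 2 := by
  simp only [stepGradU, dif_pos hj]
  rw [Q.expect_localIter w ⟨j, hj⟩ fun z B =>
    ‖Q.batchGradU k B z.1 z.2 - Q.localGradU k z.1 z.2‖ ^ 2]
  exact Finset.expect_le Finset.univ_nonempty fun Bs _ => h.var_u k _ _

theorem BoundedVariance.expect_stepGradV (h : Q.BoundedVariance σu σv) (w : Q.U × Q.V k) (j : ℕ)
    (hj : j < E) :
    𝔼 Bs : Fin E → Q.Batch k, ‖Q.stepGradV ηu ηv k w j Bs
      - Q.localGradV k (Q.localIter ηu ηv k Bs w j).1 (Q.localIter ηu ηv k Bs w j).2‖ ^ 2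
      ≤ σv ^ 2 := by
  simp only [stepGradV, dif_pos hj]
  rw [Q.expect_localIter w ⟨j, hj⟩ fun z B =>
    ‖Q.batchGradV k B z.1 z.2 - Q.localGradV k z.1 z.2‖ ^ 2]
  exact Finset.expect_le Finset.univ_nonempty fun Bs _ => h.var_v k _ _

end FedProblem

/-! ### Elementary sums and sampling without replacement. -/

/-- The term `n = 0` vanishes and each of the other E - 1 terms is at most E². Keeping E - 1 here
produces the factor 1 - 1/E of the drift. -/
theorem sum_range_sq_le (E : ℕ) :
    ∑ n ∈ Finset.range E, (n : ℝ) ^ 2 ≤ (E : ℝ) ^ 2 * (E - 1) := by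
  cases E with
  | zero => simp
  | succ E =>
    rw [Finset.sum_range_succ']
    have h : ∀ n ∈ Finset.range E, ((n + 1 : ℕ) : ℝ) ^ 2 ≤ ((E + 1 : ℕ) : ℝ) ^ 2 := by
      intro n hn
      have := Finset.mem_range.1 hn
      gcongr
    refine (add_le_add_left (Finset.sum_le_sum h) _).trans (le_of_eq ?_)
    simp
    ring

theorem sum_range_id_le (E : ℕ) : ∑ n ∈ Finset.range E, (n : ℝ) ≤ (E : ℝ) ^ 2 := by
  have h : ∀ n ∈ Finset.range E, (n : ℝ) ≤ E := fun n hn => by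
    exact_mod_cast (Finset.mem_range.1 hn).le
  refine (Finset.sum_le_sum h).trans (le_of_eq ?_)
  simp
  ring

/-- The second moment of the sum over a random `M`-subset of vectors with sum zero. -/
theorem expect_norm_sum_subset_sq_le {K M : ℕ} (hM : 1 ≤ M) (hMK : M ≤ K) {H : Type*}
    [SeminormedAddCommGroup H] (a : Fin K → H) (ha : ∑ k, a k = 0) :
    𝔼 S : {S : Finset (Fin K) // S.card = M}, ‖∑ k ∈ S.1, a k‖ ^ 2
      ≤ 2 * (M : ℝ) ^ 2 * (1 - M / K) * ((∑ k, ‖a k‖ ^ 2) / K) := by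
  have hM' : (1 : ℝ) ≤ M := by exact_mod_cast hM
  have hMK' : (M : ℝ) ≤ K := by exact_mod_cast hMK
  have hK : (0 : ℝ) < K := by linarith
  have hsamp := expect_sum_mem_subset (α := Fin K) (m := M) (by simpa using hMK)
    (by simpa using lt_of_lt_of_le hM hMK) (fun k => ‖a k‖ ^ 2)
  rw [Fintype.card_fin] at hsamp
  set A := ∑ k, ‖a k‖ ^ 2 with hA
  have hA0 : 0 ≤ A := Finset.sum_nonneg fun k _ => sq_nonneg _
  have hne : Nonempty {S : Finset (Fin K) // S.card = M} := by
    obtain ⟨S, -, hS⟩ := Finset.exists_subset_card_eq (s := (Finset.univ : Finset (Fin K)))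
      (by simpa using hMK)
    exact ⟨⟨S, hS⟩⟩
  -- Cauchy–Schwarz is applied to the smaller of the subset and its complement. As the vectors sum
  -- to zero, both partial sums have the same norm; the factor 2 makes pairwise inclusion
  -- probabilities unnecessary.
  rcases le_total (2 * M) K with h | h
  · have h' : 2 * (M : ℝ) ≤ K := by exact_mod_cast h
    have h1 : ∀ S : {S : Finset (Fin K) // S.card = M},
        ‖∑ k ∈ S.1, a k‖ ^ 2 ≤ M * ∑ k ∈ S.1, ‖a k‖ ^ 2 := by
      intro S
      simpa [S.2] using norm_sum_sq_le_card_mul S.1 a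
    refine (Finset.expect_le_expect fun S _ => h1 S).trans ?_
    rw [← Finset.mul_expect, hsamp]
    have h2 : 2 * (M : ℝ) ^ 2 * (1 - M / K) * (A / K) - M * (M / K * A)
        = M ^ 2 * A * (K - 2 * M) / K ^ 2 := by
      field_simp
      ring
    have h3 : 0 ≤ (M : ℝ) ^ 2 * A * (K - 2 * M) / K ^ 2 := by
      have : 0 ≤ (K : ℝ) - 2 * M := by linarith
      positivity
    linarith
  · have h' : (K : ℝ) ≤ 2 * M := by exact_mod_cast h
    have h1 : ∀ S : {S : Finset (Fin K) // S.card = M},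
        ‖∑ k ∈ S.1, a k‖ ^ 2 ≤ (K - M) * (A - ∑ k ∈ S.1, ‖a k‖ ^ 2) := by
      intro S
      have h2 := norm_sum_sq_le_card_mul S.1ᶜ a
      have h3 : ∑ k ∈ S.1ᶜ, a k = -∑ k ∈ S.1, a k := by
        rw [eq_neg_iff_add_eq_zero, Finset.sum_compl_add_sum, ha]
      have h4 : ∑ k ∈ S.1ᶜ, ‖a k‖ ^ 2 = A - ∑ k ∈ S.1, ‖a k‖ ^ 2 := by
        rw [eq_sub_iff_add_eq, Finset.sum_compl_add_sum]
      rwa [h3, h4, norm_neg, Finset.card_compl, S.2, Fintype.card_fin, Nat.cast_sub hMK] at h2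
    refine (Finset.expect_le_expect fun S _ => h1 S).trans ?_
    rw [← Finset.mul_expect, Finset.expect_sub_distrib, hsamp, Fintype.expect_const]
    have h2 : 2 * (M : ℝ) ^ 2 * (1 - M / K) * (A / K) - (K - M) * (A - M / K * A)
        = A * (K - M) * (2 * M ^ 2 - K * (K - M)) / K ^ 2 := by
      field_simp
    have h3 : 0 ≤ A * (K - M) * (2 * M ^ 2 - K * (K - M)) / (K : ℝ) ^ 2 := by
      have h4 : 0 ≤ (K : ℝ) - M := by linarith
      have h5 : 0 ≤ (2 * M ^ 2 - K * (K - M) : ℝ) := by nlinarith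
      positivity
    linarith

/-! ### Joint smoothness in the weighted distance. -/

namespace FedProblem

variable {K : ℕ} {Q : FedProblem K} {Lu Lv Luv Lvu X : ℝ}

/-- After scaling the blocks by √L_u and √L_v the bound is √L_u times the pairing of (1, X) with the
scaled displacements; Cauchy–Schwarz gives 1 + X². -/
theorem IsSmooth.gradU_sub_sq_le (h : Q.IsSmooth Lu Lv Luv Lvu) (hLu : 0 < Lu) (hLv : 0 < Lv)
    (hX : Luv ≤ X * √(Lu * Lv)) (k : Fin K) (u u' : Q.U) (v v' : Q.V k) :
    ‖Q.localGradU k u' v' - Q.localGradU k u v‖ ^ 2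
      ≤ Lu * (1 + X ^ 2) * (Lu * ‖u' - u‖ ^ 2 + Lv * ‖v' - v‖ ^ 2) := by
  have h1 : ‖Q.localGradU k u' v' - Q.localGradU k u v‖
      ≤ Lu * ‖u' - u‖ + X * √(Lu * Lv) * ‖v' - v‖ := by
    rw [← sub_add_sub_cancel _ (Q.localGradU k u v')]
    refine (norm_add_le _ _).trans (add_le_add (h.lip_uu k u' u v') ((h.lip_uv k u v' v).trans ?_))
    gcongr
  refine (pow_le_pow_left₀ (norm_nonneg _) h1 2).trans ?_
  rw [Real.sqrt_mul hLu.le]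
  have e1 := Real.sq_sqrt hLu.le
  have e2 := Real.sq_sqrt hLv.le
  set p := √Lu
  set q := √Lv
  rw [← e1, ← e2]
  -- Lagrange's identity: this square is exactly the defect in Cauchy–Schwarz.
  nlinarith [mul_nonneg (sq_nonneg p) (sq_nonneg (X * (p * ‖u' - u‖) - q * ‖v' - v‖))]

theorem IsSmooth.gradV_sub_sq_le (h : Q.IsSmooth Lu Lv Luv Lvu) (hLu : 0 < Lu) (hLv : 0 < Lv)
    (hX : Lvu ≤ X * √(Lu * Lv)) (k : Fin K) (u u' : Q.U) (v v' : Q.V k) :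
    ‖Q.localGradV k u' v' - Q.localGradV k u v‖ ^ 2
      ≤ Lv * (1 + X ^ 2) * (Lu * ‖u' - u‖ ^ 2 + Lv * ‖v' - v‖ ^ 2) := by
  have h1 : ‖Q.localGradV k u' v' - Q.localGradV k u v‖
      ≤ X * √(Lu * Lv) * ‖u' - u‖ + Lv * ‖v' - v‖ := by
    rw [← sub_add_sub_cancel _ (Q.localGradV k u v')]
    refine (norm_add_le _ _).trans (add_le_add ((h.lip_vu k u' u v').trans ?_) (h.lip_vv k u v' v))
    gcongr
  refine (pow_le_pow_left₀ (norm_nonneg _) h1 2).trans ?_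
  rw [Real.sqrt_mul hLu.le]
  have e1 := Real.sq_sqrt hLu.le
  have e2 := Real.sq_sqrt hLv.le
  set p := √Lu
  set q := √Lv
  rw [← e1, ← e2]
  nlinarith [mul_nonneg (sq_nonneg q) (sq_nonneg (X * (q * ‖v' - v‖) - p * ‖u' - u‖))]

/-- Joint descent inequality for a local objective. -/
theorem IsSmooth.localObj_le (h : Q.IsSmooth Lu Lv Luv Lvu) (hLu : 0 < Lu) (hLv : 0 < Lv)
    (hX : Lvu ≤ X * √(Lu * Lv)) (hX0 : 0 ≤ X) (k : Fin K) (u u' : Q.U) (v v' : Q.V k) :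
    Q.localObj k u' v' ≤ Q.localObj k u v + inner ℝ (Q.localGradU k u v) (u' - u)
      + inner ℝ (Q.localGradV k u v) (v' - v)
      + (1 + X ^ 2) * (Lu * ‖u' - u‖ ^ 2 + Lv * ‖v' - v‖ ^ 2) := by
  -- The path changes u first and then v, so the v-gradient appears at `u'`; moving it back to `u`
  -- costs the cross term bounded by `L_vu`.
  have h1 := le_add_inner_gradient_of_lipschitz (Q.differentiable_localObj_v k u')
    (fun x y => h.lip_vv k u' x y) v v'
  have h2 := le_add_inner_gradient_of_lipschitz (Q.differentiable_localObj_u k v)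
    (fun x y => h.lip_uu k x y v) u u'
  have h3 := real_inner_le_norm (Q.localGradV k u' v - Q.localGradV k u v) (v' - v)
  rw [inner_sub_left] at h3
  have h4 : ‖Q.localGradV k u' v - Q.localGradV k u v‖ ≤ X * √(Lu * Lv) * ‖u' - u‖ := by
    refine (h.lip_vu k u' u v).trans ?_
    gcongr
  have h5 := mul_le_mul_of_nonneg_right h4 (norm_nonneg (v' - v))
  change Q.localObj k u' v' ≤ Q.localObj k u' v + inner ℝ (Q.localGradV k u' v) (v' - v) + _ at h1
  change Q.localObj k u' v ≤ Q.localObj k u v + inner ℝ (Q.localGradU k u v) (u' - u) + _ at h2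
  rw [Real.sqrt_mul hLu.le] at h5
  have e1 := Real.sq_sqrt hLu.le
  have e2 := Real.sq_sqrt hLv.le
  set p := √Lu
  set q := √Lv
  rw [← e1] at h2 ⊢
  rw [← e2] at h1 ⊢
  have h6 : X * (p * q) * ‖u' - u‖ * ‖v' - v‖
      ≤ X / 2 * (p ^ 2 * ‖u' - u‖ ^ 2 + q ^ 2 * ‖v' - v‖ ^ 2) := by
    nlinarith [mul_nonneg hX0 (sq_nonneg (p * ‖u' - u‖ - q * ‖v' - v‖))]
  have h7 : (1 + X) / 2 * (p ^ 2 * ‖u' - u‖ ^ 2 + q ^ 2 * ‖v' - v‖ ^ 2)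
      ≤ (1 + X ^ 2) * (p ^ 2 * ‖u' - u‖ ^ 2 + q ^ 2 * ‖v' - v‖ ^ 2) := by
    refine mul_le_mul_of_nonneg_right ?_ (by positivity)
    nlinarith [sq_nonneg (X - 1)]
  linarith

theorem inner_globalGradU (hK : 0 < K) (G u : Q.U) (v : (k : Fin K) → Q.V k) :
    ∑ k, inner ℝ G (Q.localGradU k u (v k)) = K * inner ℝ G (Q.globalGradU u v) := by
  have hK' : (0 : ℝ) < K := by exact_mod_cast hK
  rw [globalGradU_eq, inner_smul_right, inner_sum]
  field_simp

theorem IsSmooth.globalObj_le (h : Q.IsSmooth Lu Lv Luv Lvu) (hK : 0 < K) (hLu : 0 < Lu)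
    (hLv : 0 < Lv) (hX : Lvu ≤ X * √(Lu * Lv)) (hX0 : 0 ≤ X) (u u' : Q.U)
    (v v' : (k : Fin K) → Q.V k) :
    Q.globalObj u' v' ≤ Q.globalObj u v + inner ℝ (Q.globalGradU u v) (u' - u)
      + (1 + X ^ 2) * (Lu * ‖u' - u‖ ^ 2)
      + ∑ k, ((K : ℝ)⁻¹ * inner ℝ (Q.localGradV k u (v k)) (v' k - v k)
        + (1 + X ^ 2) * ((K : ℝ)⁻¹ * (Lv * ‖v' k - v k‖ ^ 2))) := by
  have hK' : (0 : ℝ) < K := by exact_mod_cast hK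
  have h1 := Finset.sum_le_sum fun k (_ : k ∈ Finset.univ) =>
    h.localObj_le hLu hLv hX hX0 k u u' (v k) (v' k)
  have h2 := div_le_div_of_nonneg_right h1 hK'.le
  refine h2.trans (le_of_eq ?_)
  have h3 : ∑ k, inner ℝ (Q.localGradU k u (v k)) (u' - u)
      = K * inner ℝ (Q.globalGradU u v) (u' - u) := by
    simpa only [real_inner_comm] using inner_globalGradU (Q := Q) hK (u' - u) u v
  simp only [mul_add, Finset.sum_add_distrib, h3, globalObj, ← Finset.mul_sum]
  simp only [Finset.sum_const, Finset.card_univ, Fintype.card_fin, nsmul_eq_mul]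
  field_simp
  ring

/-- Weighted squared distance of the local model from its start after `n` steps. -/
noncomputable def stepDist (Q : FedProblem K) (ηu ηv Lu Lv : ℝ) {E : ℕ} (k : Fin K)
    (w : Q.U × Q.V k) (n : ℕ) (Bs : Fin E → Q.Batch k) : ℝ :=
  Lu * ‖(Q.localIter ηu ηv k Bs w n).1 - w.1‖ ^ 2 + Lv * ‖(Q.localIter ηu ηv k Bs w n).2 - w.2‖ ^ 2

/-- The expected weighted client drift, averaged over the local steps. -/
noncomputable def localDrift (Q : FedProblem K) (ηu ηv Lu Lv : ℝ) (E : ℕ) (k : Fin K)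
    (w : Q.U × Q.V k) : ℝ :=
  (∑ n ∈ Finset.range E, 𝔼 Bs : Fin E → Q.Batch k, Q.stepDist ηu ηv Lu Lv k w n Bs) / E

/-! ### Expected movement and drift of one client. -/

section Client

variable {σu σv c ηu ηv : ℝ} {E : ℕ}

theorem expect_localIter_fst_sub_sq_le
    (hs : Q.IsSmooth Lu Lv Luv Lvu) (hv : Q.BoundedVariance σu σv) (hLu : 0 < Lu) (hLv : 0 < Lv)
    (hXu : Luv ≤ X * √(Lu * Lv)) (hE : 1 ≤ E) (hηu : ηu = c / (Lu * E)) (k : Fin K)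
    (w : Q.U × Q.V k) {n : ℕ} (hn : n ≤ E) :
    Lu * 𝔼 Bs : Fin E → Q.Batch k, ‖(Q.localIter ηu ηv k Bs w n).1 - w.1‖ ^ 2
      ≤ c ^ 2 / E ^ 2 * (2 * n ^ 2 * (‖Q.localGradU k w.1 w.2‖ ^ 2 / Lu)
        + 4 * n * (1 + X ^ 2) * ∑ j ∈ Finset.range n,
            𝔼 Bs : Fin E → Q.Batch k, Q.stepDist ηu ηv Lu Lv k w j Bs
        + 4 * n ^ 2 * (σu ^ 2 / Lu)) :=
  expect_norm_block_sub_sq_le (y := fun n Bs => (Q.localIter ηu ηv k Bs w n).1)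
    (a := Q.stepGradU ηu ηv k w)
    (m := fun j Bs => Q.localGradU k (Q.localIter ηu ηv k Bs w j).1 (Q.localIter ηu ηv k Bs w j).2)
    (d := Q.stepDist ηu ηv Lu Lv k w)
    hE hLu
    (fun n x => by rw [localIter_fst_eq, hηu]) (hv.expect_stepGradU w)
    (fun _ _ => hs.gradU_sub_sq_le hLu hLv hXu k _ _ _ _) hn

theorem expect_localIter_snd_sub_sq_le
    (hs : Q.IsSmooth Lu Lv Luv Lvu) (hv : Q.BoundedVariance σu σv) (hLu : 0 < Lu) (hLv : 0 < Lv)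
    (hXv : Lvu ≤ X * √(Lu * Lv)) (hE : 1 ≤ E) (hηv : ηv = c / (Lv * E)) (k : Fin K)
    (w : Q.U × Q.V k) {n : ℕ} (hn : n ≤ E) :
    Lv * 𝔼 Bs : Fin E → Q.Batch k, ‖(Q.localIter ηu ηv k Bs w n).2 - w.2‖ ^ 2
      ≤ c ^ 2 / E ^ 2 * (2 * n ^ 2 * (‖Q.localGradV k w.1 w.2‖ ^ 2 / Lv)
        + 4 * n * (1 + X ^ 2) * ∑ j ∈ Finset.range n,
            𝔼 Bs : Fin E → Q.Batch k, Q.stepDist ηu ηv Lu Lv k w j Bs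
        + 4 * n ^ 2 * (σv ^ 2 / Lv)) :=
  expect_norm_block_sub_sq_le (y := fun n Bs => (Q.localIter ηu ηv k Bs w n).2)
    (a := Q.stepGradV ηu ηv k w)
    (m := fun j Bs => Q.localGradV k (Q.localIter ηu ηv k Bs w j).1 (Q.localIter ηu ηv k Bs w j).2)
    (d := Q.stepDist ηu ηv Lu Lv k w)
    hE hLv
    (fun n x => by rw [localIter_snd_eq, hηv]) (hv.expect_stepGradV w)
    (fun _ _ => hs.gradV_sub_sq_le hLu hLv hXv k _ _ _ _) hn

theorem expect_localRun_fst_sub_add_smul_sq_le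
    (hs : Q.IsSmooth Lu Lv Luv Lvu) (hv : Q.BoundedVariance σu σv) (hLu : 0 < Lu) (hLv : 0 < Lv)
    (hXu : Luv ≤ X * √(Lu * Lv)) (hE : 1 ≤ E) (hηu : ηu = c / (Lu * E)) (k : Fin K)
    (w : Q.U × Q.V k) :
    Lu * 𝔼 Bs : Fin E → Q.Batch k,
        ‖(Q.localRun ηu ηv k Bs w).1 - w.1 + (c / Lu) • Q.localGradU k w.1 w.2‖ ^ 2
      ≤ 2 * c ^ 2 * ((1 + X ^ 2) * Q.localDrift ηu ηv Lu Lv E k w + σu ^ 2 / Lu) := by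
  simp only [localRun_eq_localIter]
  exact expect_norm_block_end_sq_le (y := fun n Bs => (Q.localIter ηu ηv k Bs w n).1)
    (a := Q.stepGradU ηu ηv k w)
    (m := fun j Bs => Q.localGradU k (Q.localIter ηu ηv k Bs w j).1 (Q.localIter ηu ηv k Bs w j).2)
    (d := Q.stepDist ηu ηv Lu Lv k w)
    hE hLu
    (fun n x => by rw [localIter_fst_eq, hηu]) (hv.expect_stepGradU w)
    (fun _ _ => hs.gradU_sub_sq_le hLu hLv hXu k _ _ _ _)

theorem expect_localRun_snd_sub_sq_le
    (hs : Q.IsSmooth Lu Lv Luv Lvu) (hv : Q.BoundedVariance σu σv) (hLu : 0 < Lu) (hLv : 0 < Lv)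
    (hXv : Lvu ≤ X * √(Lu * Lv)) (hE : 1 ≤ E) (hηv : ηv = c / (Lv * E)) (k : Fin K)
    (w : Q.U × Q.V k) :
    Lv * 𝔼 Bs : Fin E → Q.Batch k, ‖(Q.localRun ηu ηv k Bs w).2 - w.2‖ ^ 2
      ≤ c ^ 2 * (2 * (‖Q.localGradV k w.1 w.2‖ ^ 2 / Lv)
        + 4 * (1 + X ^ 2) * Q.localDrift ηu ηv Lu Lv E k w + 4 * (σv ^ 2 / Lv)) := by
  have hE' : (0 : ℝ) < E := by exact_mod_cast hE
  simp only [localRun_eq_localIter]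
  refine (expect_localIter_snd_sub_sq_le hs hv hLu hLv hXv hE hηv k w le_rfl).trans (le_of_eq ?_)
  rw [localDrift]
  field_simp

theorem expect_inner_localRun_fst_sub_le
    (hs : Q.IsSmooth Lu Lv Luv Lvu) (hLu : 0 < Lu) (hLv : 0 < Lv) (hXu : Luv ≤ X * √(Lu * Lv))
    (hE : 1 ≤ E) (hc : 0 < c) (hηu : ηu = c / (Lu * E)) (k : Fin K) (w : Q.U × Q.V k) (G : Q.U) :
    𝔼 Bs : Fin E → Q.Batch k, inner ℝ G ((Q.localRun ηu ηv k Bs w).1 - w.1)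
      ≤ - (c / Lu) * inner ℝ G (Q.localGradU k w.1 w.2) + c / 2 * (‖G‖ ^ 2 / Lu)
        + c / 2 * (1 + X ^ 2) * Q.localDrift ηu ηv Lu Lv E k w := by
  simp only [localRun_eq_localIter]
  exact expect_inner_block_end_le (y := fun n Bs => (Q.localIter ηu ηv k Bs w n).1)
    (a := Q.stepGradU ηu ηv k w)
    (m := fun j Bs => Q.localGradU k (Q.localIter ηu ηv k Bs w j).1 (Q.localIter ηu ηv k Bs w j).2)
    (d := Q.stepDist ηu ηv Lu Lv k w)
    hE hLu hc
    (fun n x => by rw [localIter_fst_eq, hηu]) G (Q.expect_inner_stepGradU w G)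
    (fun _ _ => hs.gradU_sub_sq_le hLu hLv hXu k _ _ _ _)

theorem expect_inner_localRun_snd_sub_le
    (hs : Q.IsSmooth Lu Lv Luv Lvu) (hLu : 0 < Lu) (hLv : 0 < Lv) (hXv : Lvu ≤ X * √(Lu * Lv))
    (hE : 1 ≤ E) (hc : 0 < c) (hηv : ηv = c / (Lv * E)) (k : Fin K) (w : Q.U × Q.V k) (G : Q.V k) :
    𝔼 Bs : Fin E → Q.Batch k, inner ℝ G ((Q.localRun ηu ηv k Bs w).2 - w.2)
      ≤ - (c / Lv) * inner ℝ G (Q.localGradV k w.1 w.2) + c / 2 * (‖G‖ ^ 2 / Lv)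
        + c / 2 * (1 + X ^ 2) * Q.localDrift ηu ηv Lu Lv E k w := by
  simp only [localRun_eq_localIter]
  exact expect_inner_block_end_le (y := fun n Bs => (Q.localIter ηu ηv k Bs w n).2)
    (a := Q.stepGradV ηu ηv k w)
    (m := fun j Bs => Q.localGradV k (Q.localIter ηu ηv k Bs w j).1 (Q.localIter ηu ηv k Bs w j).2)
    (d := Q.stepDist ηu ηv Lu Lv k w)
    hE hLv hc
    (fun n x => by rw [localIter_snd_eq, hηv]) G (Q.expect_inner_stepGradV w G)
    (fun _ _ => hs.gradV_sub_sq_le hLu hLv hXv k _ _ _ _)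

theorem stepDist_nonneg (k : Fin K) (w : Q.U × Q.V k) (hLu : 0 < Lu) (hLv : 0 < Lv) (n : ℕ) (Bs : Fin E → Q.Batch k) :
    0 ≤ Q.stepDist ηu ηv Lu Lv k w n Bs := by
  unfold stepDist
  positivity

theorem localDrift_nonneg (k : Fin K) (w : Q.U × Q.V k) (hLu : 0 < Lu) (hLv : 0 < Lv) :
    0 ≤ Q.localDrift ηu ηv Lu Lv E k w :=
  div_nonneg (Finset.sum_nonneg fun _ _ => Finset.expect_nonneg fun _ _ =>
    stepDist_nonneg k w hLu hLv _ _) (Nat.cast_nonneg _)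

/-- The client drift is of second order in the step size and absent for a single local step. -/
theorem localDrift_le
    (hs : Q.IsSmooth Lu Lv Luv Lvu) (hv : Q.BoundedVariance σu σv) (hLu : 0 < Lu) (hLv : 0 < Lv)
    (hXu : Luv ≤ X * √(Lu * Lv)) (hXv : Lvu ≤ X * √(Lu * Lv)) (hE : 1 ≤ E)
    (hηu : ηu = c / (Lu * E)) (hηv : ηv = c / (Lv * E)) (k : Fin K) (w : Q.U × Q.V k) (hcX : 16 * (1 + X ^ 2) * c ^ 2 ≤ 1) :
    Q.localDrift ηu ηv Lu Lv E k w
      ≤ 8 * c ^ 2 * (1 - 1 / E) * (‖Q.localGradU k w.1 w.2‖ ^ 2 / Lu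
        + ‖Q.localGradV k w.1 w.2‖ ^ 2 / Lv + σu ^ 2 / Lu + σv ^ 2 / Lv) := by
  have hE' : (0 : ℝ) < E := by exact_mod_cast hE
  set D := Q.localDrift ηu ηv Lu Lv E k w with hD
  set N := ‖Q.localGradU k w.1 w.2‖ ^ 2 / Lu + ‖Q.localGradV k w.1 w.2‖ ^ 2 / Lv
    + σu ^ 2 / Lu + σv ^ 2 / Lv with hN
  have hD0 : 0 ≤ D := localDrift_nonneg k w hLu hLv
  have hN0 : 0 ≤ N := by positivity
  have hsum : ∑ n ∈ Finset.range E, 𝔼 Bs : Fin E → Q.Batch k, Q.stepDist ηu ηv Lu Lv k w n Bs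
      = E * D := by
    rw [hD, localDrift]
    field_simp
  have hstep : ∀ n ∈ Finset.range E, 𝔼 Bs : Fin E → Q.Batch k, Q.stepDist ηu ηv Lu Lv k w n Bs
      ≤ c ^ 2 / E ^ 2 * (4 * N) * (n : ℝ) ^ 2
        + c ^ 2 / E ^ 2 * (8 * (1 + X ^ 2) * (E * D)) * n := by
    intro n hn
    have hn' := (Finset.mem_range.1 hn).le
    have h1 := expect_localIter_fst_sub_sq_le (ηv := ηv) hs hv hLu hLv hXu hE hηu k w hn'
    have h2 := expect_localIter_snd_sub_sq_le (ηu := ηu) hs hv hLu hLv hXv hE hηv k w hn'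
    -- Enlarging the partial sum to the whole run makes the recursion an implicit inequality for the
    -- single number `D`.
    have h3 : ∑ j ∈ Finset.range n, 𝔼 Bs : Fin E → Q.Batch k, Q.stepDist ηu ηv Lu Lv k w j Bs
        ≤ E * D := by
      rw [← hsum]
      exact Finset.sum_le_sum_of_subset_of_nonneg (Finset.range_subset_range.2 hn')
        fun _ _ _ => Finset.expect_nonneg fun _ _ => stepDist_nonneg k w hLu hLv _ _
    set Sn := ∑ j ∈ Finset.range n, 𝔼 Bs : Fin E → Q.Batch k, Q.stepDist ηu ηv Lu Lv k w j Bs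
    have h4 : 𝔼 Bs : Fin E → Q.Batch k, Q.stepDist ηu ηv Lu Lv k w n Bs
        = Lu * 𝔼 Bs : Fin E → Q.Batch k, ‖(Q.localIter ηu ηv k Bs w n).1 - w.1‖ ^ 2
          + Lv * 𝔼 Bs : Fin E → Q.Batch k, ‖(Q.localIter ηu ηv k Bs w n).2 - w.2‖ ^ 2 := by
      simp only [stepDist, Finset.expect_add_distrib, Finset.mul_expect]
    rw [h4]
    refine (add_le_add h1 h2).trans ?_
    have hgu : 0 ≤ ‖Q.localGradU k w.1 w.2‖ ^ 2 / Lu := by positivity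
    have hgv : 0 ≤ ‖Q.localGradV k w.1 w.2‖ ^ 2 / Lv := by positivity
    have h5 : 4 * (n : ℝ) * (1 + X ^ 2) * Sn ≤ 4 * (n : ℝ) * (1 + X ^ 2) * (E * D) := by gcongr
    have h6 : (0 : ℝ) ≤ n ^ 2 := by positivity
    have h7 : (2 * (n : ℝ) ^ 2 * (‖Q.localGradU k w.1 w.2‖ ^ 2 / Lu)
        + 4 * n * (1 + X ^ 2) * Sn + 4 * n ^ 2 * (σu ^ 2 / Lu))
        + (2 * (n : ℝ) ^ 2 * (‖Q.localGradV k w.1 w.2‖ ^ 2 / Lv)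
        + 4 * n * (1 + X ^ 2) * Sn + 4 * n ^ 2 * (σv ^ 2 / Lv))
        ≤ 4 * N * n ^ 2 + 8 * (1 + X ^ 2) * (E * D) * n := by
      rw [hN]
      nlinarith [mul_nonneg h6 hgu, mul_nonneg h6 hgv]
    have h8 := mul_le_mul_of_nonneg_left h7 (show 0 ≤ c ^ 2 / (E : ℝ) ^ 2 by positivity)
    linarith
  have h1 := Finset.sum_le_sum hstep
  rw [hsum, Finset.sum_add_distrib, ← Finset.mul_sum, ← Finset.mul_sum] at h1
  have h2 : c ^ 2 / (E : ℝ) ^ 2 * (4 * N) * ∑ n ∈ Finset.range E, (n : ℝ) ^ 2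
      ≤ c ^ 2 / (E : ℝ) ^ 2 * (4 * N) * ((E : ℝ) ^ 2 * (E - 1)) := by
    gcongr
    exact sum_range_sq_le E
  have h3 : c ^ 2 / (E : ℝ) ^ 2 * (8 * (1 + X ^ 2) * (E * D)) * ∑ n ∈ Finset.range E, (n : ℝ)
      ≤ c ^ 2 / (E : ℝ) ^ 2 * (8 * (1 + X ^ 2) * (E * D)) * (E : ℝ) ^ 2 := by
    gcongr
    exact sum_range_id_le E
  have h4 : (E : ℝ) * D ≤ E * (4 * c ^ 2 * (1 - 1 / E) * N + 8 * (1 + X ^ 2) * c ^ 2 * D) := by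
    refine h1.trans ((add_le_add h2 h3).trans (le_of_eq ?_))
    field_simp
  have h5 := le_of_mul_le_mul_left h4 hE'
  -- The coefficient 8(1 + X²)c² of `D` on the right is at most 1/2, so `D` is absorbed and the
  -- constant 4 doubles to 8.
  have h6 := mul_le_mul_of_nonneg_right hcX hD0
  linarith

end Client

end FedProblem

/-! ### Expected decrease in one communication round. -/

theorem norm_inv_smul_sum_sq_le {ι H : Type*} [SeminormedAddCommGroup H] [NormedSpace ℝ H]
    {s : Finset ι} {M : ℕ} (hs : s.card = M) (hM : 1 ≤ M) (a : ι → H) :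
    ‖(M : ℝ)⁻¹ • ∑ i ∈ s, a i‖ ^ 2 ≤ (M : ℝ)⁻¹ * ∑ i ∈ s, ‖a i‖ ^ 2 := by
  have hM' : (0 : ℝ) < M := by exact_mod_cast hM
  have h := norm_sum_sq_le_card_mul s a
  rw [hs] at h
  rw [norm_smul, mul_pow, Real.norm_eq_abs, sq_abs]
  refine (mul_le_mul_of_nonneg_left h (sq_nonneg _)).trans (le_of_eq ?_)
  field_simp

/-- The scalar core of a round: a, b are the squared gradients, z, p, q the noise levels, D the mean
drift, and m = M/K, ρ = 1 + X², r = 1 + P², s = 1 - 1/E. The drift enters with total coefficient at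
most 2cρ; by the two smallness conditions on `c`, all gradient terms created use up at most half of
the decrease (c/2)(a + b). -/
theorem round_decrease_arith {a b z p q D m ρ r s c : ℝ} (ha : 0 ≤ a) (hb : 0 ≤ b)
    (hp : 0 ≤ p) (hq : 0 ≤ q) (hD0 : 0 ≤ D) (hm0 : 0 < m) (hm1 : m ≤ 1) (hρ : 1 ≤ ρ) (hr : 1 ≤ r)
    (hs0 : 0 ≤ s) (hs1 : s ≤ 1) (hc : 0 < c) (hc1 : 96 * (ρ * r) * c ≤ 1)
    (hc2 : 192 * (m⁻¹ * s * ρ) * c ^ 2 ≤ 1)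
    (hD : D ≤ 8 * c ^ 2 * s * (2 * r * a + 2 * z + m⁻¹ * b + p + q)) :
    ρ * (2 * c ^ 2) * (4 * r * a + 4 * (1 - m) * z)
      + (-(c / 2) * (a + b) + c / 2 * (1 + m) * ρ * D
        + ρ * (4 * c ^ 2 * (1 + m) * ρ * D + 4 * c ^ 2 * p + 2 * c ^ 2 * b + 4 * c ^ 2 * m * q))
      ≤ - (c / 4) * (a + b) + 8 * c ^ 2 * ρ * (z * (1 - m) + p + m * q)
        + 32 * c ^ 3 * ρ * s * (z + p + q) := by
  have hρ0 : 0 < ρ := by linarith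
  have hcρ : 96 * ρ * c ≤ 1 := by
    nlinarith [mul_nonneg (mul_nonneg hρ0.le hc.le) (sub_nonneg.2 hr)]
  have h1 : c / 2 * (1 + m) * ρ * D ≤ c * ρ * D := by
    have : 0 ≤ c / 2 * ρ * D * (1 - m) := by
      have := sub_nonneg.2 hm1
      positivity
    linarith
  have h2 : ρ * (4 * c ^ 2 * (1 + m) * ρ * D) ≤ c * ρ * D := by
    have h3 : 0 ≤ 4 * (c * ρ) ^ 2 * D * (1 - m) := by
      have := sub_nonneg.2 hm1
      positivity
    have h4 : 96 * ρ * c * (c * ρ * D) ≤ 1 * (c * ρ * D) := by gcongr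
    have h5 : 0 ≤ c * ρ * D := by positivity
    linarith
  have h3 : 2 * c * ρ * D ≤ 2 * c * ρ * (8 * c ^ 2 * s * (2 * r * a + 2 * z + m⁻¹ * b + p + q)) := by
    gcongr
  have h4 : 96 * (ρ * r) * c * (c * a) ≤ 1 * (c * a) := by gcongr
  have h5 : 96 * ρ * c * (c * b) ≤ 1 * (c * b) := by gcongr
  have h6 : 192 * (m⁻¹ * s * ρ) * c ^ 2 * (c * b) ≤ 1 * (c * b) := by gcongr
  have h7 : 96 * (ρ * r) * c ^ 3 * a * s ≤ c * a / 96 := by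
    have hc96 : c ≤ 1 / 96 := by nlinarith
    have h8 : c * s ≤ 1 / 96 * 1 := by gcongr
    calc 96 * (ρ * r) * c ^ 3 * a * s = 96 * (ρ * r) * c * (c * a) * (c * s) := by ring
      _ ≤ 1 * (c * a) * (1 / 96 * 1) := by gcongr
      _ = c * a / 96 := by ring
  have h8 : 0 ≤ c ^ 3 * ρ * s * p := by positivity
  have h9 : 0 ≤ c ^ 3 * ρ * s * q := by positivity
  have h10 : 0 ≤ c ^ 2 * ρ * p := by positivity
  have h11 : 0 ≤ c ^ 2 * ρ * (m * q) := by positivity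
  have h12 : 0 ≤ c * a := by positivity
  have h13 : 0 ≤ c * b := by positivity
  linarith

namespace FedProblem

variable {K : ℕ} {Q : FedProblem K} {Lu Lv Luv Lvu X σu σv ζ P c ηu ηv : ℝ} {M E : ℕ}

theorem nonempty_subset_card (hMK : M ≤ K) : Nonempty {S : Finset (Fin K) // S.card = M} := by
  obtain ⟨S, -, hS⟩ := Finset.exists_subset_card_eq (s := (Finset.univ : Finset (Fin K)))
    (by simpa using hMK)
  exact ⟨⟨S, hS⟩⟩

theorem expect_round_eq (f : {S : Finset (Fin K) // S.card = M} →
    ((k : Fin K) → Fin E → Q.Batch k) → ℝ) :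
    𝔼 o : Q.Round M E, f o.1 o.2 = 𝔼 S, 𝔼 Bs, f S Bs := by
  rw [← Finset.univ_product_univ, Finset.expect_product]

/-- Expectation of a sum over the selected clients. -/
theorem expect_sum_selected (hM : 1 ≤ M) (hMK : M ≤ K)
    (f : (k : Fin K) → (Fin E → Q.Batch k) → ℝ) :
    𝔼 o : Q.Round M E, ∑ k ∈ o.1.1, f k (o.2 k)
      = (M : ℝ) / K * ∑ k, 𝔼 Bs : Fin E → Q.Batch k, f k Bs := by
  rw [expect_round_eq fun S Bs => ∑ k ∈ S.1, f k (Bs k)]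
  simp only [Finset.expect_sum_comm, expect_coord]
  rw [expect_sum_mem_subset (by simpa using hMK) (by simpa using lt_of_lt_of_le hM hMK),
    Fintype.card_fin]

/-- This controls the drift, which involves individual gradients rather than sampled averages; hence
ζ² enters the second noise level without the factor 1 - M/K. -/
theorem BoundedHeterogeneity.mean_norm_gradU_sq_le (hK : 0 < K) (hh : Q.BoundedHeterogeneity ζ P)
    (u : Q.U) (v : (k : Fin K) → Q.V k) :
    (∑ k, ‖Q.localGradU k u (v k)‖ ^ 2) / K
      ≤ 2 * (1 + P ^ 2) * ‖Q.globalGradU u v‖ ^ 2 + 2 * ζ ^ 2 := by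
  have hK' : (0 : ℝ) < K := by exact_mod_cast hK
  set G := Q.globalGradU u v
  have h1 : ∀ k, ‖Q.localGradU k u (v k)‖ ^ 2
      ≤ 2 * ‖Q.localGradU k u (v k) - G‖ ^ 2 + 2 * ‖G‖ ^ 2 := fun k => by
    simpa using norm_add_sq_le_two_mul (Q.localGradU k u (v k) - G) G
  have h2 := div_le_div_of_nonneg_right (Finset.sum_le_sum fun k (_ : k ∈ Finset.univ) => h1 k)
    hK'.le
  rw [Finset.sum_add_distrib, ← Finset.mul_sum, Finset.sum_const, Finset.card_univ,
    Fintype.card_fin, nsmul_eq_mul, add_div, mul_div_assoc, mul_div_cancel_left₀ _ hK'.ne'] at h2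
  linarith [hh u v]

/-- Second moment of the average of the selected clients' gradients. -/
theorem BoundedHeterogeneity.expect_norm_selected_sq_le (hM : 1 ≤ M) (hMK : M ≤ K)
    (hh : Q.BoundedHeterogeneity ζ P) (u : Q.U) (v : (k : Fin K) → Q.V k) :
    𝔼 o : Q.Round M E, ‖(M : ℝ)⁻¹ • ∑ k ∈ o.1.1, Q.localGradU k u (v k)‖ ^ 2
      ≤ 4 * (1 + P ^ 2) * ‖Q.globalGradU u v‖ ^ 2 + 4 * (1 - M / K) * ζ ^ 2 := by
  have hM' : (0 : ℝ) < M := by exact_mod_cast hM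
  have hMK' : (M : ℝ) ≤ K := by exact_mod_cast hMK
  have hK' : (0 : ℝ) < K := by linarith
  have := nonempty_subset_card hMK
  set G := Q.globalGradU u v with hG
  rw [expect_round_eq fun S _ => ‖(M : ℝ)⁻¹ • ∑ k ∈ S.1, Q.localGradU k u (v k)‖ ^ 2]
  simp only [Fintype.expect_const]
  -- Centring at the global gradient gives the zero sum that the subset estimate requires.
  have hzero : ∑ k, (Q.localGradU k u (v k) - G) = 0 := by
    rw [Finset.sum_sub_distrib, hG, globalGradU_eq]
    simp only [Finset.sum_const, Finset.card_univ, Fintype.card_fin, ← Nat.cast_smul_eq_nsmul ℝ]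
    rw [smul_smul, mul_inv_cancel₀ hK'.ne', one_smul, sub_self]
  have h1 : ∀ S : {S : Finset (Fin K) // S.card = M},
      ‖(M : ℝ)⁻¹ • ∑ k ∈ S.1, Q.localGradU k u (v k)‖ ^ 2
        ≤ 2 * ‖G‖ ^ 2 + 2 * ((M : ℝ)⁻¹ ^ 2 * ‖∑ k ∈ S.1, (Q.localGradU k u (v k) - G)‖ ^ 2) := by
    intro S
    have e : (M : ℝ)⁻¹ • ∑ k ∈ S.1, Q.localGradU k u (v k)
        = G + (M : ℝ)⁻¹ • ∑ k ∈ S.1, (Q.localGradU k u (v k) - G) := by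
      rw [Finset.sum_sub_distrib, Finset.sum_const, S.2, ← Nat.cast_smul_eq_nsmul ℝ, smul_sub,
        smul_smul, inv_mul_cancel₀ hM'.ne', one_smul, add_sub_cancel]
    rw [e]
    refine (norm_add_sq_le_two_mul _ _).trans (le_of_eq ?_)
    rw [norm_smul, mul_pow, Real.norm_eq_abs, sq_abs]
  refine (Finset.expect_le_expect fun S _ => h1 S).trans ?_
  rw [Finset.expect_add_distrib, Fintype.expect_const, ← Finset.mul_expect, ← Finset.mul_expect]
  have h2 := expect_norm_sum_subset_sq_le hM hMK _ hzero
  have hm : (M : ℝ) / K ≤ 1 := (div_le_one hK').2 hMK'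
  have h3 : (M : ℝ)⁻¹ ^ 2 * 𝔼 S : {S : Finset (Fin K) // S.card = M},
      ‖∑ k ∈ S.1, (Q.localGradU k u (v k) - G)‖ ^ 2
      ≤ 2 * (1 - M / K) * (ζ ^ 2 + P ^ 2 * ‖G‖ ^ 2) := by
    refine (mul_le_mul_of_nonneg_left h2 (by positivity)).trans ?_
    have h4 := mul_le_mul_of_nonneg_left (hh u v) (show 0 ≤ 2 * (1 - (M : ℝ) / K) by linarith)
    refine le_trans (le_of_eq ?_) h4
    field_simp
    rfl
  have h5 : 0 ≤ (M : ℝ) / K * (P ^ 2 * ‖G‖ ^ 2) := by positivity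
  nlinarith [sq_nonneg ‖G‖]

/-- The weighted squared gradient norm of a state. -/
noncomputable def weightedSqGrad (Q : FedProblem K) (M : ℕ) (Lu Lv : ℝ) (s : Q.State) : ℝ :=
  1 / Lu * ‖Q.globalGradU s.u s.v‖ ^ 2
    + (M : ℝ) / (Lv * (K : ℝ) ^ 2) * ∑ k, ‖Q.localGradV k s.u (s.v k)‖ ^ 2

/-- The contribution of a selected client to the bound on the objective after a round. -/
noncomputable def clientTerm (Q : FedProblem K) (ηu ηv Lu Lv X c : ℝ) (M : ℕ) (s : Q.State)
    (k : Fin K) (Bs : Fin E → Q.Batch k) : ℝ :=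
  (M : ℝ)⁻¹ * inner ℝ (Q.globalGradU s.u s.v) ((Q.localRun ηu ηv k Bs (s.u, s.v k)).1 - s.u)
    + (K : ℝ)⁻¹ * inner ℝ (Q.localGradV k s.u (s.v k))
        ((Q.localRun ηu ηv k Bs (s.u, s.v k)).2 - s.v k)
    + (1 + X ^ 2) * (2 * (M : ℝ)⁻¹ * (Lu * ‖(Q.localRun ηu ηv k Bs (s.u, s.v k)).1 - s.u
        + (c / Lu) • Q.localGradU k s.u (s.v k)‖ ^ 2)
      + (K : ℝ)⁻¹ * (Lv * ‖(Q.localRun ηu ηv k Bs (s.u, s.v k)).2 - s.v k‖ ^ 2))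

/-- The server displacement is split into an ideal step along the averaged selected gradients and a
remainder. The ideal step stays under one norm, where sampling cancellation can act; convexity turns
the remainder into a sum over selected clients, whose expectation decouples. -/
theorem IsSmooth.globalObj_roundStep_le (hs : Q.IsSmooth Lu Lv Luv Lvu) (hM : 1 ≤ M) (hMK : M ≤ K)
    (hLu : 0 < Lu) (hLv : 0 < Lv) (hXv : Lvu ≤ X * √(Lu * Lv)) (hX0 : 0 ≤ X) (s : Q.State)
    (o : Q.Round M E) :
    Q.globalObj (Q.roundStep ηu ηv o s).u (Q.roundStep ηu ηv o s).v
      ≤ Q.globalObj s.u s.v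
        + (1 + X ^ 2) * (2 * (c ^ 2 / Lu)) *
          ‖(M : ℝ)⁻¹ • ∑ k ∈ o.1.1, Q.localGradU k s.u (s.v k)‖ ^ 2
        + ∑ k ∈ o.1.1, Q.clientTerm ηu ηv Lu Lv X c M s k (o.2 k) := by
  have hM' : (0 : ℝ) < M := by exact_mod_cast hM
  let Y : (k : Fin K) → Q.U := fun k => (Q.localRun ηu ηv k (o.2 k) (s.u, s.v k)).1 - s.u
  let Z : (k : Fin K) → Q.V k := fun k => (Q.localRun ηu ηv k (o.2 k) (s.u, s.v k)).2 - s.v k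
  let g : (k : Fin K) → Q.U := fun k => Q.localGradU k s.u (s.v k)
  have hdu : (Q.roundStep ηu ηv o s).u - s.u = (M : ℝ)⁻¹ • ∑ k ∈ o.1.1, Y k := by
    simp only [Y, Finset.sum_sub_distrib, Finset.sum_const, o.1.2, roundStep,
      ← Nat.cast_smul_eq_nsmul ℝ]
    rw [smul_sub, smul_smul, inv_mul_cancel₀ hM'.ne', one_smul]
  have hdv : ∀ k, (Q.roundStep ηu ηv o s).v k - s.v k = if k ∈ o.1.1 then Z k else 0 := by
    intro k
    simp only [roundStep, Z]
    split_ifs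
    · rfl
    · rw [sub_self]
  have h1 := hs.globalObj_le (lt_of_lt_of_le hM hMK) hLu hLv hXv hX0 s.u
    (Q.roundStep ηu ηv o s).u s.v (Q.roundStep ηu ηv o s).v
  have hsum : ∑ k, ((K : ℝ)⁻¹ * inner ℝ (Q.localGradV k s.u (s.v k))
        ((Q.roundStep ηu ηv o s).v k - s.v k)
        + (1 + X ^ 2) * ((K : ℝ)⁻¹ * (Lv * ‖(Q.roundStep ηu ηv o s).v k - s.v k‖ ^ 2)))
      = ∑ k ∈ o.1.1, ((K : ℝ)⁻¹ * inner ℝ (Q.localGradV k s.u (s.v k)) (Z k)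
        + (1 + X ^ 2) * ((K : ℝ)⁻¹ * (Lv * ‖Z k‖ ^ 2))) := by
    rw [← Finset.sum_subset (Finset.subset_univ o.1.1)]
    · exact Finset.sum_congr rfl fun k hk => by rw [hdv, if_pos hk]
    · intro k _ hk
      rw [hdv, if_neg hk]
      simp
  have h2 : ‖(Q.roundStep ηu ηv o s).u - s.u‖ ^ 2
      ≤ 2 * ((M : ℝ)⁻¹ * ∑ k ∈ o.1.1, ‖Y k + (c / Lu) • g k‖ ^ 2)
        + 2 * ((c / Lu) ^ 2 * ‖(M : ℝ)⁻¹ • ∑ k ∈ o.1.1, g k‖ ^ 2) := by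
    have e : (M : ℝ)⁻¹ • ∑ k ∈ o.1.1, Y k = (M : ℝ)⁻¹ • ∑ k ∈ o.1.1, (Y k + (c / Lu) • g k)
        + -((c / Lu) • ((M : ℝ)⁻¹ • ∑ k ∈ o.1.1, g k)) := by
      rw [Finset.sum_add_distrib, ← Finset.smul_sum]
      module
    rw [hdu, e]
    refine (norm_add_sq_le_two_mul _ _).trans ?_
    rw [norm_neg, norm_smul (c / Lu), mul_pow, Real.norm_eq_abs, sq_abs]
    gcongr
    exact norm_inv_smul_sum_sq_le o.1.2 hM _
  rw [hsum, hdu, inner_smul_right, inner_sum, ← hdu] at h1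
  have h3 := mul_le_mul_of_nonneg_left h2 (show 0 ≤ (1 + X ^ 2) * Lu by positivity)
  have h4 : ∑ k ∈ o.1.1, Q.clientTerm ηu ηv Lu Lv X c M s k (o.2 k)
      = (M : ℝ)⁻¹ * ∑ k ∈ o.1.1, inner ℝ (Q.globalGradU s.u s.v) (Y k)
        + (1 + X ^ 2) * Lu * (2 * ((M : ℝ)⁻¹ * ∑ k ∈ o.1.1, ‖Y k + (c / Lu) • g k‖ ^ 2))
        + ∑ k ∈ o.1.1, ((K : ℝ)⁻¹ * inner ℝ (Q.localGradV k s.u (s.v k)) (Z k)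
        + (1 + X ^ 2) * ((K : ℝ)⁻¹ * (Lv * ‖Z k‖ ^ 2))) := by
    simp only [Finset.mul_sum, ← Finset.sum_add_distrib]
    refine Finset.sum_congr rfl fun k _ => ?_
    simp only [clientTerm, Y, Z, g]
    ring
  have h5 : (1 + X ^ 2) * Lu * (2 * ((c / Lu) ^ 2 * ‖(M : ℝ)⁻¹ • ∑ k ∈ o.1.1, g k‖ ^ 2))
      = (1 + X ^ 2) * (2 * (c ^ 2 / Lu)) *
          ‖(M : ℝ)⁻¹ • ∑ k ∈ o.1.1, Q.localGradU k s.u (s.v k)‖ ^ 2 := by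
    simp only [g]
    field_simp
  rw [h4, ← h5]
  linarith

theorem expect_clientTerm_le (hs : Q.IsSmooth Lu Lv Luv Lvu) (hv : Q.BoundedVariance σu σv)
    (hLu : 0 < Lu) (hLv : 0 < Lv) (hXu : Luv ≤ X * √(Lu * Lv)) (hXv : Lvu ≤ X * √(Lu * Lv))
    (hE : 1 ≤ E) (hc : 0 < c) (hηu : ηu = c / (Lu * E)) (hηv : ηv = c / (Lv * E)) (M : ℕ)
    (s : Q.State) (k : Fin K) :
    𝔼 Bs : Fin E → Q.Batch k, Q.clientTerm ηu ηv Lu Lv X c M s k Bs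
      ≤ (M : ℝ)⁻¹ * (- (c / Lu) * inner ℝ (Q.globalGradU s.u s.v) (Q.localGradU k s.u (s.v k))
          + c / 2 * (‖Q.globalGradU s.u s.v‖ ^ 2 / Lu)
          + c / 2 * (1 + X ^ 2) * Q.localDrift ηu ηv Lu Lv E k (s.u, s.v k))
        + (K : ℝ)⁻¹ * (- (c / 2) * (‖Q.localGradV k s.u (s.v k)‖ ^ 2 / Lv)
          + c / 2 * (1 + X ^ 2) * Q.localDrift ηu ηv Lu Lv E k (s.u, s.v k))
        + (1 + X ^ 2) * (2 * (M : ℝ)⁻¹ * (2 * c ^ 2 * ((1 + X ^ 2) *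
            Q.localDrift ηu ηv Lu Lv E k (s.u, s.v k) + σu ^ 2 / Lu))
          + (K : ℝ)⁻¹ * (c ^ 2 * (2 * (‖Q.localGradV k s.u (s.v k)‖ ^ 2 / Lv)
            + 4 * (1 + X ^ 2) * Q.localDrift ηu ηv Lu Lv E k (s.u, s.v k)
            + 4 * (σv ^ 2 / Lv)))) := by
  have h1 := expect_inner_localRun_fst_sub_le (ηv := ηv) hs hLu hLv hXu hE hc hηu k (s.u, s.v k)
    (Q.globalGradU s.u s.v)
  have h2 := expect_inner_localRun_snd_sub_le (ηu := ηu) hs hLu hLv hXv hE hc hηv k (s.u, s.v k)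
    (Q.localGradV k s.u (s.v k))
  have h3 := expect_localRun_fst_sub_add_smul_sq_le (ηv := ηv) hs hv hLu hLv hXu hE hηu k
    (s.u, s.v k)
  have h4 := expect_localRun_snd_sub_sq_le (ηu := ηu) hs hv hLu hLv hXv hE hηv k (s.u, s.v k)
  simp only [clientTerm, Finset.expect_add_distrib, ← Finset.mul_expect]
  -- Testing the private block against its own gradient gives -c + c/2 = -c/2.
  have h2' : 𝔼 Bs : Fin E → Q.Batch k, inner ℝ (Q.localGradV k s.u (s.v k))
        ((Q.localRun ηu ηv k Bs (s.u, s.v k)).2 - s.v k)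
      ≤ - (c / 2) * (‖Q.localGradV k s.u (s.v k)‖ ^ 2 / Lv)
          + c / 2 * (1 + X ^ 2) * Q.localDrift ηu ηv Lu Lv E k (s.u, s.v k) := by
    refine h2.trans (le_of_eq ?_)
    rw [real_inner_self_eq_norm_sq]
    ring
  gcongr

/-- The client drift averaged over the clients. -/
theorem mean_localDrift_le (hs : Q.IsSmooth Lu Lv Luv Lvu)
    (hv : Q.BoundedVariance σu σv) (hh : Q.BoundedHeterogeneity ζ P) (hM : 1 ≤ M) (hMK : M ≤ K)
    (hLu : 0 < Lu) (hLv : 0 < Lv) (hXu : Luv ≤ X * √(Lu * Lv)) (hXv : Lvu ≤ X * √(Lu * Lv))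
    (hE : 1 ≤ E) (hηu : ηu = c / (Lu * E)) (hηv : ηv = c / (Lv * E))
    (hcX : 16 * (1 + X ^ 2) * c ^ 2 ≤ 1) (s : Q.State) :
    (∑ k, Q.localDrift ηu ηv Lu Lv E k (s.u, s.v k)) / K
      ≤ 8 * c ^ 2 * (1 - 1 / (E : ℝ)) * (2 * (1 + P ^ 2) * (‖Q.globalGradU s.u s.v‖ ^ 2 / Lu)
        + 2 * (ζ ^ 2 / Lu) + (M / K : ℝ)⁻¹ *
          (M / (Lv * K ^ 2) * ∑ k, ‖Q.localGradV k s.u (s.v k)‖ ^ 2)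
        + σu ^ 2 / Lu + σv ^ 2 / Lv) := by
  have hM' : (0 : ℝ) < M := by exact_mod_cast hM
  have hK' : (0 : ℝ) < K := by exact_mod_cast hM.trans hMK
  have hE' : (1 : ℝ) ≤ E := by exact_mod_cast hE
  have hs0 : (0 : ℝ) ≤ 1 - 1 / E := by
    have := (div_le_one (by linarith)).2 hE'
    linarith
  have hD := Finset.sum_le_sum fun k (_ : k ∈ Finset.univ) =>
    localDrift_le (σu := σu) (σv := σv) hs hv hLu hLv hXu hXv hE hηu hηv k (s.u, s.v k) hcX
  have hg := hh.mean_norm_gradU_sq_le (hM.trans hMK) s.u s.v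
  simp only [Finset.sum_add_distrib, ← Finset.mul_sum, ← Finset.sum_div,
    Finset.sum_const, Finset.card_univ, Fintype.card_fin, nsmul_eq_mul] at hD
  set g2 := ∑ k, ‖Q.localGradU k s.u (s.v k)‖ ^ 2
  -- The private gradients enter the drift with weight 1/K but the target with weight M/K². This
  -- ratio is the origin of K/M in the rate.
  have h1 : (∑ k, Q.localDrift ηu ηv Lu Lv E k (s.u, s.v k)) / K
      ≤ 8 * c ^ 2 * (1 - 1 / (E : ℝ)) * (g2 / K / Lu + (M / K : ℝ)⁻¹ *
        (M / (Lv * K ^ 2) * ∑ k, ‖Q.localGradV k s.u (s.v k)‖ ^ 2)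
        + σu ^ 2 / Lu + σv ^ 2 / Lv) := by
    refine (div_le_div_of_nonneg_right hD hK'.le).trans (le_of_eq ?_)
    rw [mul_div_assoc]
    congr 1
    field_simp
  have h2 : g2 / K / Lu
      ≤ 2 * (1 + P ^ 2) * (‖Q.globalGradU s.u s.v‖ ^ 2 / Lu) + 2 * (ζ ^ 2 / Lu) := by
    refine (div_le_div_of_nonneg_right hg hLu.le).trans (le_of_eq ?_)
    ring
  refine h1.trans ?_
  gcongr

/-- The expected contribution of the selected clients. -/
theorem expect_sum_clientTerm_le (hs : Q.IsSmooth Lu Lv Luv Lvu)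
    (hv : Q.BoundedVariance σu σv) (hM : 1 ≤ M) (hMK : M ≤ K)
    (hLu : 0 < Lu) (hLv : 0 < Lv) (hXu : Luv ≤ X * √(Lu * Lv)) (hXv : Lvu ≤ X * √(Lu * Lv))
    (hE : 1 ≤ E) (hc : 0 < c) (hηu : ηu = c / (Lu * E)) (hηv : ηv = c / (Lv * E)) (s : Q.State) :
    (M : ℝ) / K * ∑ k, 𝔼 Bs : Fin E → Q.Batch k, Q.clientTerm ηu ηv Lu Lv X c M s k Bs
      ≤ -(c / 2) * (‖Q.globalGradU s.u s.v‖ ^ 2 / Lu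
          + M / (Lv * K ^ 2) * ∑ k, ‖Q.localGradV k s.u (s.v k)‖ ^ 2)
        + c / 2 * (1 + M / K) * (1 + X ^ 2)
          * ((∑ k, Q.localDrift ηu ηv Lu Lv E k (s.u, s.v k)) / K)
        + (1 + X ^ 2) * (4 * c ^ 2 * (1 + M / K) * (1 + X ^ 2)
            * ((∑ k, Q.localDrift ηu ηv Lu Lv E k (s.u, s.v k)) / K) + 4 * c ^ 2 * (σu ^ 2 / Lu)
          + 2 * c ^ 2 * (M / (Lv * K ^ 2) * ∑ k, ‖Q.localGradV k s.u (s.v k)‖ ^ 2)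
          + 4 * c ^ 2 * (M / K) * (σv ^ 2 / Lv)) := by
  have hM' : (0 : ℝ) < M := by exact_mod_cast hM
  have hK' : (0 : ℝ) < K := by exact_mod_cast hM.trans hMK
  have hT := mul_le_mul_of_nonneg_left (Finset.sum_le_sum fun k (_ : k ∈ Finset.univ) =>
    expect_clientTerm_le hs hv hLu hLv hXu hXv hE hc hηu hηv M s k)
    (show 0 ≤ (M : ℝ) / K by positivity)
  -- Averaged over the clients, the pairing with the global gradient becomes its squared norm, which
  -- leaves -c/2 for the shared block.
  have hinner := inner_globalGradU (Q := Q) (hM.trans hMK) (Q.globalGradU s.u s.v) s.u s.v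
  rw [real_inner_self_eq_norm_sq] at hinner
  simp only [Finset.sum_add_distrib, mul_add, ← Finset.mul_sum, ← Finset.sum_div, hinner,
    Finset.sum_const, Finset.card_univ, Fintype.card_fin, nsmul_eq_mul] at hT
  refine hT.trans (le_of_eq ?_)
  generalize ‖Q.globalGradU s.u s.v‖ ^ 2 = G2
  generalize ∑ k, ‖Q.localGradV k s.u (s.v k)‖ ^ 2 = H2
  generalize ∑ k, Q.localDrift ηu ηv Lu Lv E k (s.u, s.v k) = D
  field_simp
  ring

/-- Expected decrease of the objective in one round. -/
theorem expect_globalObj_roundStep_le (hs : Q.IsSmooth Lu Lv Luv Lvu)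
    (hv : Q.BoundedVariance σu σv) (hh : Q.BoundedHeterogeneity ζ P) (hM : 1 ≤ M) (hMK : M ≤ K)
    (hLu : 0 < Lu) (hLv : 0 < Lv) (hXu : Luv ≤ X * √(Lu * Lv)) (hXv : Lvu ≤ X * √(Lu * Lv))
    (hX0 : 0 ≤ X) (hE : 1 ≤ E) (hc : 0 < c) (hηu : ηu = c / (Lu * E)) (hηv : ηv = c / (Lv * E))
    (hc1 : 96 * ((1 + X ^ 2) * (1 + P ^ 2)) * c ≤ 1)
    (hc2 : 192 * ((K : ℝ) / M * (1 - 1 / (E : ℝ)) * (1 + X ^ 2)) * c ^ 2 ≤ 1) (s : Q.State) :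
    𝔼 o : Q.Round M E, Q.globalObj (Q.roundStep ηu ηv o s).u (Q.roundStep ηu ηv o s).v
      ≤ Q.globalObj s.u s.v - c / 4 * Q.weightedSqGrad M Lu Lv s
        + 8 * c ^ 2 * (1 + X ^ 2) * noiseOne K M Lu Lv σu σv ζ
        + 32 * c ^ 3 * (1 + X ^ 2) * (1 - 1 / (E : ℝ)) * noiseTwo Lu Lv σu σv ζ := by
  have hM' : (0 : ℝ) < M := by exact_mod_cast hM
  have hMK' : (M : ℝ) ≤ K := by exact_mod_cast hMK
  have hK' : (0 : ℝ) < K := by linarith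
  have hE' : (1 : ℝ) ≤ E := by exact_mod_cast hE
  have := nonempty_subset_card hMK
  have hcX : 16 * (1 + X ^ 2) * c ^ 2 ≤ 1 := by
    have h1 : 1 ≤ 1 + X ^ 2 := by nlinarith
    have h2 : (1 + X ^ 2) * c ≤ (1 + X ^ 2) * (1 + P ^ 2) * c := by
      nlinarith [mul_nonneg (mul_nonneg (show 0 ≤ 1 + X ^ 2 by positivity) (sq_nonneg P)) hc.le]
    nlinarith
  have h0 := Finset.expect_le_expect (s := Finset.univ) fun (o : Q.Round M E) _ =>
    hs.globalObj_roundStep_le (c := c) (ηu := ηu) (ηv := ηv) hM hMK hLu hLv hXv hX0 s o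
  rw [Finset.expect_add_distrib, Finset.expect_add_distrib, Fintype.expect_const,
    ← Finset.mul_expect, expect_sum_selected hM hMK] at h0
  refine h0.trans ?_
  have hS := mul_le_mul_of_nonneg_left (hh.expect_norm_selected_sq_le (E := E) hM hMK s.u s.v)
    (show 0 ≤ (1 + X ^ 2) * (2 * (c ^ 2 / Lu)) by positivity)
  have hT := expect_sum_clientTerm_le hs hv hM hMK hLu hLv hXu hXv hE hc hηu hηv s
  have hD := mean_localDrift_le hs hv hh hM hMK hLu hLv hXu hXv hE hηu hηv hcX s
  have hD0 : 0 ≤ (∑ k, Q.localDrift ηu ηv Lu Lv E k (s.u, s.v k)) / K :=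
    div_nonneg (Finset.sum_nonneg fun k _ => localDrift_nonneg k _ hLu hLv) hK'.le
  refine (add_le_add (add_le_add_right hS _) hT).trans ?_
  unfold weightedSqGrad noiseOne noiseTwo
  have hG0 : 0 ≤ ‖Q.globalGradU s.u s.v‖ ^ 2 := sq_nonneg _
  have hH0 : 0 ≤ ∑ k, ‖Q.localGradV k s.u (s.v k)‖ ^ 2 :=
    Finset.sum_nonneg fun k _ => sq_nonneg _
  clear hS hT h0
  revert hD0 hD hG0 hH0
  generalize ‖Q.globalGradU s.u s.v‖ ^ 2 = G2
  generalize ∑ k, ‖Q.localGradV k s.u (s.v k)‖ ^ 2 = H2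
  generalize (∑ k, Q.localDrift ηu ηv Lu Lv E k (s.u, s.v k)) / K = D
  generalize Q.globalObj s.u s.v = Φ
  intro hD hD0 hG0 hH0
  have hm1 : (M : ℝ) / K ≤ 1 := (div_le_one hK').2 hMK'
  have hE0 : (0 : ℝ) ≤ 1 / E := by positivity
  have hE1 : (1 : ℝ) / E ≤ 1 := (div_le_one (by linarith)).2 hE'
  have hfin := round_decrease_arith (a := G2 / Lu) (b := M / (Lv * K ^ 2) * H2) (z := ζ ^ 2 / Lu)
    (p := σu ^ 2 / Lu) (q := σv ^ 2 / Lv) (D := D) (m := M / K) (ρ := 1 + X ^ 2)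
    (r := 1 + P ^ 2) (s := 1 - 1 / (E : ℝ)) (c := c) (by positivity) (by positivity) (by positivity)
    (by positivity) hD0 (by positivity) hm1 (le_add_of_nonneg_right (sq_nonneg _))
    (le_add_of_nonneg_right (sq_nonneg _)) (sub_nonneg.2 hE1) (sub_le_self _ hE0) hc hc1
    (by rwa [inv_div]) hD
  have e1 : (M : ℝ) * σv ^ 2 / (K * Lv) = M / K * (σv ^ 2 / Lv) := by field_simp
  have e2 : (1 + X ^ 2) * (2 * (c ^ 2 / Lu)) * (4 * (1 + P ^ 2) * G2 + 4 * (1 - M / K) * ζ ^ 2)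
      = (1 + X ^ 2) * (2 * c ^ 2)
        * (4 * (1 + P ^ 2) * (G2 / Lu) + 4 * (1 - M / K) * (ζ ^ 2 / Lu)) := by ring
  rw [e1, e2, one_div_mul_eq_div]
  linarith

end FedProblem

/-! ### Choice of the step constant and the threshold. -/

theorem rpow_third_of_pow_three {x : ℝ} (hx : 0 ≤ x) : (x ^ 3) ^ ((1 : ℝ) / 3) = x := by
  have h := Real.pow_rpow_inv_natCast hx (n := 3) (by norm_num)
  rwa [Nat.cast_ofNat, ← one_div] at h

theorem rpow_third_pow_three {x : ℝ} (hx : 0 ≤ x) : (x ^ ((1 : ℝ) / 3)) ^ 3 = x := by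
  have h := Real.rpow_inv_natCast_pow hx (n := 3) (by norm_num)
  rwa [Nat.cast_ofNat, ← one_div] at h

/-- Balancing the terms of the convergence bound by the choice of the step constant. -/
theorem balanced_rate_le {W c Δ T ρ r κ s N₁ N₂ : ℝ} (hΔ : 0 < Δ) (hT : 0 < T)
    (hρ : 0 < ρ) (hr : 0 < r) (hs : 0 ≤ s) (hN₁ : 0 ≤ N₁) (hN₂ : 0 ≤ N₂)
    (hW : W = 96 * (ρ * r) + 14 * √(κ * s * ρ * r) + √(T * ρ * N₁ / Δ)
      + (T * ρ * s * N₂ / Δ) ^ ((1 : ℝ) / 3)) (hc : c = W⁻¹) :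
    4 * Δ / (c * T) + 32 * c * ρ * N₁ + 128 * c ^ 2 * ρ * s * N₂
      ≤ 400 * (√(Δ * ρ * N₁ / T) + (Δ ^ 2 * ρ * N₂ * s / T ^ 2) ^ ((1 : ℝ) / 3)
        + Δ * ρ * r / T + Δ * √(κ * s * ρ * r) / T) := by
  have h1 : 0 ≤ T * ρ * N₁ / Δ := by positivity
  have h2 : 0 ≤ T * ρ * s * N₂ / Δ := by positivity
  have e1 : √(Δ * ρ * N₁ / T) = Δ / T * √(T * ρ * N₁ / Δ) := by
    rw [← Real.sqrt_sq (show 0 ≤ Δ / T by positivity), ← Real.sqrt_mul (sq_nonneg _)]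
    congr 1
    field_simp
  have e2 : (Δ ^ 2 * ρ * N₂ * s / T ^ 2) ^ ((1 : ℝ) / 3)
      = Δ / T * (T * ρ * s * N₂ / Δ) ^ ((1 : ℝ) / 3) := by
    have : Δ ^ 2 * ρ * N₂ * s / T ^ 2 = (Δ / T) ^ 3 * (T * ρ * s * N₂ / Δ) := by field_simp
    rw [this, Real.mul_rpow (by positivity) h2, rpow_third_of_pow_three (by positivity)]
  -- Writing the noise as a power of its root in `W` lets `c` times that root be bounded by 1,
  -- leaving one factor of the root.
  have f1 : ρ * N₁ = √(T * ρ * N₁ / Δ) ^ 2 * (Δ / T) := by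
    rw [Real.sq_sqrt h1]
    field_simp
  have f2 : ρ * s * N₂ = ((T * ρ * s * N₂ / Δ) ^ ((1 : ℝ) / 3)) ^ 3 * (Δ / T) := by
    rw [rpow_third_pow_three h2]
    field_simp
  rw [e1, e2]
  have p1 : 0 ≤ √(T * ρ * N₁ / Δ) := Real.sqrt_nonneg _
  have p2 : 0 ≤ (T * ρ * s * N₂ / Δ) ^ ((1 : ℝ) / 3) := by positivity
  have p3 : 0 ≤ √(κ * s * ρ * r) := Real.sqrt_nonneg _
  have p4 : 0 < ρ * r := by positivity
  generalize √(T * ρ * N₁ / Δ) = r₁ at *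
  generalize (T * ρ * s * N₂ / Δ) ^ ((1 : ℝ) / 3) = r₂ at *
  generalize √(κ * s * ρ * r) = r₃ at *
  have hW0 : 0 < W := by rw [hW]; positivity
  have hc0 : 0 < c := by rw [hc]; positivity
  have hcW : c * W = 1 := by rw [hc, inv_mul_cancel₀ hW0.ne']
  have c1 : c * r₁ ≤ 1 := by
    rw [← hcW]
    gcongr
    linarith
  have c2 : c * r₂ ≤ 1 := by
    rw [← hcW]
    gcongr
    linarith
  have d1 : c * (ρ * N₁) ≤ Δ / T * r₁ := by
    calc c * (ρ * N₁) = (c * r₁) * (Δ / T * r₁) := by rw [f1]; ring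
      _ ≤ 1 * (Δ / T * r₁) := by gcongr
      _ = _ := one_mul _
  have d2 : c ^ 2 * (ρ * s * N₂) ≤ Δ / T * r₂ := by
    calc c ^ 2 * (ρ * s * N₂) = (c * r₂) ^ 2 * (Δ / T * r₂) := by rw [f2]; ring
      _ ≤ 1 ^ 2 * (Δ / T * r₂) := by gcongr
      _ = _ := by ring
  -- Since 1/c = W is a sum, this term splits exactly into the four rates. With the noise added the
  -- coefficients are 384, 56, 4 + 32 and 4 + 128, all below 400.
  have d3 : 4 * Δ / (c * T) = 384 * (Δ * ρ * r / T) + 56 * (Δ * r₃ / T) + 4 * (Δ / T * r₁)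
      + 4 * (Δ / T * r₂) := by
    rw [hc, hW]
    field_simp
    ring
  have q1 : 0 ≤ Δ / T * r₁ := by positivity
  have q2 : 0 ≤ Δ / T * r₂ := by positivity
  have q3 : 0 ≤ Δ * ρ * r / T := by positivity
  have q4 : 0 ≤ Δ * r₃ / T := by positivity
  linarith

/-- Beyond the threshold the first term dominates the other ones. -/
theorem rate_le_of_threshold {Δ T ρ r κ s N₁ N₂ : ℝ} (hΔ : 0 < Δ) (hT : 0 < T)
    (hρ : 1 ≤ ρ) (hr : 1 ≤ r) (hκ : 0 ≤ κ) (hs : 0 ≤ s) (hN₁ : 0 < N₁) (hN₂ : 0 ≤ N₂)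
    (hthr : r * Δ ≤ N₁ * T) :
    √(Δ * ρ * N₁ / T) + (Δ ^ 2 * ρ * N₂ * s / T ^ 2) ^ ((1 : ℝ) / 3)
        + Δ * ρ * r / T + Δ * √(κ * s * ρ * r) / T
      ≤ (1 + √(ρ * r) + √(κ * s) + (s * N₂ / N₁) ^ ((1 : ℝ) / 3)) * √(Δ * ρ * N₁ / T) := by
  have hρ0 : 0 < ρ := by linarith
  have hr0 : 0 < r := by linarith
  set y := Δ * ρ * N₁ / T with hy
  have hy0 : 0 ≤ y := by positivity
  -- The threshold in squared form: it bounds Δ/T · √(ρr) by √y, and each remaining term is compared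
  -- with √y through this.
  have hsq : (Δ / T) ^ 2 * (ρ * r) ≤ y := by
    have e : y - (Δ / T) ^ 2 * (ρ * r) = Δ * ρ / T ^ 2 * (N₁ * T - r * Δ) := by
      rw [hy]
      field_simp
    have : 0 ≤ Δ * ρ / T ^ 2 * (N₁ * T - r * Δ) := mul_nonneg (by positivity) (by linarith)
    linarith
  have hroot : Δ / T * √(ρ * r) ≤ √y := by
    refine Real.le_sqrt_of_sq_le ?_
    rwa [mul_pow, Real.sq_sqrt (by positivity)]
  have h3 : Δ * ρ * r / T ≤ √(ρ * r) * √y := by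
    have e : Δ * ρ * r / T = √(ρ * r) * (Δ / T * √(ρ * r)) := by
      have := Real.mul_self_sqrt (show 0 ≤ ρ * r by positivity)
      linear_combination (-(Δ / T)) * this
    rw [e]
    gcongr
  have h4 : Δ * √(κ * s * ρ * r) / T ≤ √(κ * s) * √y := by
    have e : Δ * √(κ * s * ρ * r) / T = √(κ * s) * (Δ / T * √(ρ * r)) := by
      rw [mul_assoc (κ * s), Real.sqrt_mul (by positivity)]
      ring
    rw [e]
    gcongr
  have h2 : (Δ ^ 2 * ρ * N₂ * s / T ^ 2) ^ ((1 : ℝ) / 3)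
      ≤ (s * N₂ / N₁) ^ ((1 : ℝ) / 3) * √y := by
    have e : Δ ^ 2 * ρ * N₂ * s / T ^ 2 = s * N₂ / N₁ * (y * (Δ / T)) := by
      rw [hy]
      field_simp
    have h5 : Δ / T ≤ √y := by
      refine le_trans ?_ hroot
      refine le_mul_of_one_le_right (by positivity) (Real.one_le_sqrt.2 ?_)
      nlinarith
    have h6 : y * (Δ / T) ≤ √y ^ 3 := by
      calc y * (Δ / T) ≤ y * √y := by gcongr
        _ = √y ^ 3 := by rw [pow_succ, Real.sq_sqrt hy0]
    rw [e, Real.mul_rpow (by positivity) (by positivity)]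
    gcongr
    calc (y * (Δ / T)) ^ ((1 : ℝ) / 3) ≤ (√y ^ 3) ^ ((1 : ℝ) / 3) := by gcongr
      _ = √y := rpow_third_of_pow_three (Real.sqrt_nonneg _)
  linarith

theorem noiseOne_nonneg {K M : ℕ} (hMK : M ≤ K) {Lu Lv : ℝ} (hLu : 0 < Lu) (hLv : 0 < Lv)
    (σu σv ζ : ℝ) : 0 ≤ noiseOne K M Lu Lv σu σv ζ := by
  have h : (M : ℝ) / K ≤ 1 := div_le_one_of_le₀ (by exact_mod_cast hMK) (Nat.cast_nonneg K)
  have h' := sub_nonneg.2 h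
  unfold noiseOne
  positivity

theorem noiseTwo_nonneg {Lu Lv : ℝ} (hLu : 0 < Lu) (hLv : 0 < Lv) (σu σv ζ : ℝ) :
    0 ≤ noiseTwo Lu Lv σu σv ζ := by
  unfold noiseTwo
  positivity

/-- The two sides differ only by a factor K on σ_u² L_v. Hence the stated threshold implies the
sharper one in terms of σ₁². -/
theorem le_mul_noiseOne {K M : ℕ} (hK : 1 ≤ K) {Lu Lv : ℝ} (hLu : 0 < Lu) (hLv : 0 < Lv)
    (σu σv ζ : ℝ) :
    ζ ^ 2 * Lv * ((K : ℝ) - M) + σu ^ 2 * Lv + M * Lu * σv ^ 2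
      ≤ K * Lv * Lu * noiseOne K M Lu Lv σu σv ζ := by
  have hK' : (1 : ℝ) ≤ K := by exact_mod_cast hK
  have e : K * Lv * Lu * noiseOne K M Lu Lv σu σv ζ
      = ζ ^ 2 * Lv * ((K : ℝ) - M) + K * (σu ^ 2 * Lv) + M * Lu * σv ^ 2 := by
    unfold noiseOne
    field_simp
  have h : 0 ≤ σu ^ 2 * Lv := by positivity
  nlinarith

/-! ### Telescoping over the rounds. -/

namespace FedProblem

variable {K : ℕ} {Q : FedProblem K} {Lu Lv Luv Lvu X σu σv ζ P c ηu ηv : ℝ} {M E : ℕ}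

theorem expectAt_succ (s₀ : Q.State) (t : ℕ) (φ : Q.State → ℝ) :
    Q.expectAt ηu ηv M E s₀ (t + 1) φ
      = Q.expectAt ηu ηv M E s₀ t
        fun s => 𝔼 o : Q.Round M E, φ (Q.roundStep ηu ηv o s) :=
  expect_init_last t fun ω o => φ (Q.roundStep ηu ηv o (Q.iterate ηu ηv s₀ t ω))

theorem avgSqGrad_eq (T : ℕ) (s₀ : Q.State) :
    Q.avgSqGrad ηu ηv M E T s₀ Lu Lv
      = (∑ t ∈ Finset.range T, Q.expectAt ηu ηv M E s₀ t (Q.weightedSqGrad M Lu Lv)) / T := by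
  simp only [avgSqGrad, expectAt, weightedSqGrad, Finset.expect_add_distrib, ← Finset.mul_expect,
    Finset.expect_sum_comm]

/-- Summation of a one-round decrease over the rounds. -/
theorem sum_expectAt_le (hMK : M ≤ K) {R Fstar : ℝ}
    (hstep : ∀ s : Q.State,
      𝔼 o : Q.Round M E, Q.globalObj (Q.roundStep ηu ηv o s).u (Q.roundStep ηu ηv o s).v
        ≤ Q.globalObj s.u s.v - c / 4 * Q.weightedSqGrad M Lu Lv s + R)
    (hF : ∀ u v, Fstar ≤ Q.globalObj u v) (s₀ : Q.State) (T : ℕ) :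
    c / 4 * ∑ t ∈ Finset.range T, Q.expectAt ηu ηv M E s₀ t (Q.weightedSqGrad M Lu Lv)
      ≤ Q.globalObj s₀.u s₀.v - Fstar + T * R := by
  have hne := nonempty_subset_card hMK
  have h : ∀ T : ℕ,
      Q.expectAt ηu ηv M E s₀ T (fun s => Q.globalObj s.u s.v)
        + c / 4 * ∑ t ∈ Finset.range T, Q.expectAt ηu ηv M E s₀ t (Q.weightedSqGrad M Lu Lv)
      ≤ Q.globalObj s₀.u s₀.v + T * R := by
    intro T
    induction T with
    | zero => simp [expectAt, iterate]
    | succ T ih =>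
      have h1 : Q.expectAt ηu ηv M E s₀ (T + 1) (fun s => Q.globalObj s.u s.v)
          ≤ Q.expectAt ηu ηv M E s₀ T (fun s => Q.globalObj s.u s.v)
            - c / 4 * Q.expectAt ηu ηv M E s₀ T (Q.weightedSqGrad M Lu Lv) + R := by
        rw [expectAt_succ]
        refine (Finset.expect_le_expect fun ω _ => hstep _).trans (le_of_eq ?_)
        rw [Finset.expect_add_distrib, Finset.expect_sub_distrib, ← Finset.mul_expect,
          Fintype.expect_const]
        rfl
      rw [Finset.sum_range_succ]
      push_cast
      linarith
  have hlow : Fstar ≤ Q.expectAt ηu ηv M E s₀ T (fun s => Q.globalObj s.u s.v) :=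
    Finset.le_expect Finset.univ_nonempty fun ω _ => hF _ _
  linarith [h T]

theorem avgSqGrad_le (hs : Q.IsSmooth Lu Lv Luv Lvu)
    (hv : Q.BoundedVariance σu σv) (hh : Q.BoundedHeterogeneity ζ P) (hM : 1 ≤ M) (hMK : M ≤ K)
    (hLu : 0 < Lu) (hLv : 0 < Lv) (hXu : Luv ≤ X * √(Lu * Lv)) (hXv : Lvu ≤ X * √(Lu * Lv))
    (hX0 : 0 ≤ X) (hE : 1 ≤ E) (hc : 0 < c) (hηu : ηu = c / (Lu * E)) (hηv : ηv = c / (Lv * E))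
    (hc1 : 96 * ((1 + X ^ 2) * (1 + P ^ 2)) * c ≤ 1)
    (hc2 : 192 * ((K : ℝ) / M * (1 - 1 / (E : ℝ)) * (1 + X ^ 2)) * c ^ 2 ≤ 1) {Fstar : ℝ}
    (hF : ∀ u v, Fstar ≤ Q.globalObj u v) (s₀ : Q.State) {T : ℕ} (hT : 1 ≤ T) :
    Q.avgSqGrad ηu ηv M E T s₀ Lu Lv
      ≤ 4 * (Q.globalObj s₀.u s₀.v - Fstar) / (c * T)
        + 32 * c * (1 + X ^ 2) * noiseOne K M Lu Lv σu σv ζ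
        + 128 * c ^ 2 * (1 + X ^ 2) * (1 - 1 / (E : ℝ)) * noiseTwo Lu Lv σu σv ζ := by
  have hT' : (0 : ℝ) < T := by exact_mod_cast hT
  have h := sum_expectAt_le (Q := Q) (ηu := ηu) (ηv := ηv) (E := E) (c := c) (Lu := Lu) (Lv := Lv)
    hMK (fun s => (expect_globalObj_roundStep_le hs hv hh hM hMK hLu hLv hXu hXv hX0 hE hc hηu hηv
      hc1 hc2 s).trans_eq (add_assoc _ _ _)) hF s₀ T
  rw [avgSqGrad_eq]
  generalize ∑ t ∈ Finset.range T, Q.expectAt ηu ηv M E s₀ t (Q.weightedSqGrad M Lu Lv) = S at *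
  have h2 := mul_le_mul_of_nonneg_left h (show 0 ≤ 4 / (c * T) by positivity)
  have e : 4 / (c * T) * (c / 4 * S) = S / T := by field_simp
  rw [e] at h2
  refine h2.trans (le_of_eq ?_)
  field_simp
  ring

end FedProblem

/-! ### The convergence theorem. -/

theorem theorem1 :
    ∃ A : ℝ, 0 < A ∧
      ∀ (K M E T : ℕ) (Lu Lv Luv Lvu X σu σv ζ P Δ : ℝ),
        1 ≤ M → M ≤ K → 1 ≤ E → 1 ≤ T →
        0 < Lu → 0 < Lv → 0 ≤ Luv → 0 ≤ Lvu →
        max (Luv / √(Lu * Lv)) (Lvu / √(Lu * Lv)) ≤ X →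
        0 ≤ σu → 0 ≤ σv → 0 ≤ ζ → 0 ≤ P → 0 < Δ →
        -- the step sizes depend only on the constants above
        ∃ ηu ηv : ℝ,
          (∃ C : ℝ, 0 < C ∧ ηu = C / (Lu * E) ∧ ηv = C / (Lv * E)) ∧
          ηu ≤ (12 * E * Lu * (1 + X ^ 2) * (1 + P ^ 2))⁻¹ ∧
          ηv ≤ (6 * E * Lv * (1 + X ^ 2))⁻¹ ∧
          ∀ (Q : FedProblem K) (s₀ : Q.State) (Fstar : ℝ),
            Q.IsSmooth Lu Lv Luv Lvu →
            Q.BoundedVariance σu σv →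
            Q.BoundedHeterogeneity ζ P →
            (∀ u v, Fstar ≤ Q.globalObj u v) →
            Q.globalObj s₀.u s₀.v - Fstar = Δ →
            -- the rate
            Q.avgSqGrad ηu ηv M E T s₀ Lu Lv ≤
              A * (√(Δ * (1 + X ^ 2) * noiseOne K M Lu Lv σu σv ζ / T)
                + (Δ ^ 2 * (1 + X ^ 2) * noiseTwo Lu Lv σu σv ζ * (1 - 1 / (E : ℝ))
                    / (T : ℝ) ^ 2) ^ ((1 : ℝ) / 3)
                + Δ * (1 + X ^ 2) * (1 + P ^ 2) / T
                + Δ * √((K : ℝ) / M * (1 - 1 / (E : ℝ)) * (1 + X ^ 2) * (1 + P ^ 2)) / T) ∧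
            -- beyond the threshold, the rate is that of the first term; the additional factor
            -- depends neither on `T` nor on `Δ`
            (0 < ζ ^ 2 * Lv * ((K : ℝ) - M) + σu ^ 2 * Lv + M * Lu * σv ^ 2 →
              K * Lv * Lu * (1 + P ^ 2) * Δ
                  / (ζ ^ 2 * Lv * ((K : ℝ) - M) + σu ^ 2 * Lv + M * Lu * σv ^ 2) ≤ T →
              Q.avgSqGrad ηu ηv M E T s₀ Lu Lv ≤
                A * (1 + √((1 + X ^ 2) * (1 + P ^ 2)) + √((K : ℝ) / M * (1 - 1 / (E : ℝ)))
                    + ((1 - 1 / (E : ℝ)) * noiseTwo Lu Lv σu σv ζ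
                        / noiseOne K M Lu Lv σu σv ζ) ^ ((1 : ℝ) / 3))
                  * √(Δ * (1 + X ^ 2) * noiseOne K M Lu Lv σu σv ζ / T)) := by
  refine ⟨400, by norm_num, ?_⟩
  intro K M E T Lu Lv Luv Lvu X σu σv ζ P Δ hM hMK hE hT hLu hLv hLuv hLvu hX hσu hσv hζ hP hΔ
  have hM' : (0 : ℝ) < M := by exact_mod_cast hM
  have hK' : (0 : ℝ) < K := by exact_mod_cast hM.trans hMK
  have hE' : (1 : ℝ) ≤ E := by exact_mod_cast hE
  have hE0 : (0 : ℝ) < E := by linarith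
  have hT' : (0 : ℝ) < T := by exact_mod_cast hT
  have hL : 0 < √(Lu * Lv) := Real.sqrt_pos.2 (mul_pos hLu hLv)
  have hXu : Luv ≤ X * √(Lu * Lv) := (div_le_iff₀ hL).1 ((le_max_left _ _).trans hX)
  have hXv : Lvu ≤ X * √(Lu * Lv) := (div_le_iff₀ hL).1 ((le_max_right _ _).trans hX)
  have hX0 : 0 ≤ X := (div_nonneg hLuv hL.le).trans ((le_max_left _ _).trans hX)
  have hρ : 1 ≤ 1 + X ^ 2 := le_add_of_nonneg_right (sq_nonneg _)
  have hr : 1 ≤ 1 + P ^ 2 := le_add_of_nonneg_right (sq_nonneg _)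
  have hs : (0 : ℝ) ≤ 1 - 1 / E := sub_nonneg.2 ((div_le_one hE0).2 hE')
  have hN₁ := noiseOne_nonneg hMK hLu hLv σu σv ζ
  have hN₂ := noiseTwo_nonneg hLu hLv σu σv ζ
  -- The first two summands enforce the smallness conditions on c = 1/W, where 14² = 196 covers 192;
  -- the last two balance the noise of orders c and c².
  obtain ⟨W, hW⟩ : ∃ W, W = 96 * ((1 + X ^ 2) * (1 + P ^ 2))
      + 14 * √((K : ℝ) / M * (1 - 1 / (E : ℝ)) * (1 + X ^ 2) * (1 + P ^ 2))
      + √(T * (1 + X ^ 2) * noiseOne K M Lu Lv σu σv ζ / Δ)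
      + (T * (1 + X ^ 2) * (1 - 1 / (E : ℝ)) * noiseTwo Lu Lv σu σv ζ / Δ) ^ ((1 : ℝ) / 3) :=
    ⟨_, rfl⟩
  have w1 : 0 ≤ √(T * (1 + X ^ 2) * noiseOne K M Lu Lv σu σv ζ / Δ) := Real.sqrt_nonneg _
  have w2 : 0 ≤ (T * (1 + X ^ 2) * (1 - 1 / (E : ℝ)) * noiseTwo Lu Lv σu σv ζ / Δ)
    ^ ((1 : ℝ) / 3) := by positivity
  have w3 := Real.sqrt_nonneg ((K : ℝ) / M * (1 - 1 / (E : ℝ)) * (1 + X ^ 2) * (1 + P ^ 2))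
  have w4 : 0 < (1 + X ^ 2) * (1 + P ^ 2) := by positivity
  have hW0 : 0 < W := by linarith
  obtain ⟨c, hc⟩ : ∃ c, c = W⁻¹ := ⟨_, rfl⟩
  have hc0 : 0 < c := by rw [hc]; positivity
  have hcW : W * c = 1 := by rw [hc, mul_inv_cancel₀ hW0.ne']
  have hc1 : 96 * ((1 + X ^ 2) * (1 + P ^ 2)) * c ≤ 1 := by
    refine le_trans ?_ hcW.le
    gcongr
    linarith
  have hc2 : 192 * ((K : ℝ) / M * (1 - 1 / (E : ℝ)) * (1 + X ^ 2)) * c ^ 2 ≤ 1 := by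
    have h1 : 0 ≤ (K : ℝ) / M * (1 - 1 / (E : ℝ)) * (1 + X ^ 2) := by positivity
    have h2 : √((K : ℝ) / M * (1 - 1 / (E : ℝ)) * (1 + X ^ 2) * (1 + P ^ 2)) * 14 * c ≤ 1 := by
      refine le_trans ?_ hcW.le
      gcongr
      linarith
    have h3 := pow_le_one₀ (n := 2) (by positivity) h2
    rw [mul_pow, mul_pow, Real.sq_sqrt (by positivity)] at h3
    have h4 := mul_le_mul_of_nonneg_right (le_mul_of_one_le_right h1 hr) (sq_nonneg c)
    have h5 := mul_nonneg h1 (sq_nonneg c)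
    linarith
  refine ⟨c / (Lu * E), c / (Lv * E), ⟨c, hc0, rfl, rfl⟩, ?_, ?_, ?_⟩
  · rw [← one_div, div_le_div_iff₀ (by positivity) (by positivity), one_mul]
    have h1 : 12 * ((1 + X ^ 2) * (1 + P ^ 2)) * c ≤ 1 := by linarith [mul_pos w4 hc0]
    calc c * (12 * E * Lu * (1 + X ^ 2) * (1 + P ^ 2))
        = 12 * ((1 + X ^ 2) * (1 + P ^ 2)) * c * (Lu * E) := by ring
      _ ≤ 1 * (Lu * E) := by gcongr
      _ = Lu * E := one_mul _
  · rw [← one_div, div_le_div_iff₀ (by positivity) (by positivity), one_mul]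
    have h1 : 6 * (1 + X ^ 2) * c ≤ 1 := by
      have h2 := mul_le_mul_of_nonneg_right
        (le_mul_of_one_le_right (zero_le_one.trans hρ) hr) hc0.le
      linarith [mul_pos w4 hc0]
    calc c * (6 * E * Lv * (1 + X ^ 2)) = 6 * (1 + X ^ 2) * c * (Lv * E) := by ring
      _ ≤ 1 * (Lv * E) := by gcongr
      _ = Lv * E := one_mul _
  intro Q s₀ Fstar hsm hvar hhet hF hΔeq
  have hbound := FedProblem.avgSqGrad_le hsm hvar hhet hM hMK hLu hLv hXu hXv hX0 hE hc0 rfl rfl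
    hc1 hc2 hF s₀ hT
  rw [hΔeq] at hbound
  have hrate := hbound.trans (balanced_rate_le hΔ hT' (by positivity) (by positivity) hs hN₁ hN₂
    hW hc)
  refine ⟨hrate, fun hpos hthr => hrate.trans ?_⟩
  have hle := le_mul_noiseOne (M := M) (hM.trans hMK) hLu hLv σu σv ζ
  have hN₁' : 0 < noiseOne K M Lu Lv σu σv ζ :=
    pos_of_mul_pos_right (hpos.trans_le hle) (by positivity)
  have hthr' : (1 + P ^ 2) * Δ ≤ noiseOne K M Lu Lv σu σv ζ * T := by
    rw [div_le_iff₀ hpos] at hthr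
    have h1 := hthr.trans (mul_le_mul_of_nonneg_left hle hT'.le)
    refine le_of_mul_le_mul_left (a := K * Lv * Lu) ?_ (by positivity)
    linarith
  rw [mul_assoc (400 : ℝ)]
  exact mul_le_mul_of_nonneg_left
    (rate_le_of_threshold hΔ hT' hρ hr (by positivity) hs hN₁' hN₂ hthr') (by norm_num)
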